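/- **Setting.** Let $d=d_s+d_u$ with $d_s,d_u\ge 1$, let $\mathbb R^d=\mathbb R^{d_s}\times\mathbb R^{d_u}$, and let $\pi_-:\mathbb R^d\to\mathbb R^{d_s}$ be the orthogonal projection. Fix a real $r>1$ and a $C^\infty$ function $\chi:\mathbb R_+\to[0,1]$ with $\chi=1$ on $[0,1]$ and $\chi=0$ on $[2,\infty)$. On $\mathbb R^m$ put $\psi_0(\xi)=\chi(\|\xi\|)$, $\psi_n(\xi)=\chi(2^{-n}\|\xi\|)-\chi(2^{-n+1}\|\xi\|)$ for $n\ge1$, and $\psi_n^{Op}\varphi=\mathbb F^{-1}(\psi_n\cdot\mathbb F\varphi)$, where $\mathbb F\varphi(\xi)=\int e^{-ix\xi}\varphi(x)\,dx$. A *cone pair* $\mathbf C_\pm=(\mathbf C_+,\mathbf C_-)$ consists of two closed subsets of $\mathbb R^d$, invariant under multiplication by real scalars, with nonempty interiors, whose linear subsets have maximal dimension $d_u$, respectively $d_s$, and with $\mathbf C_+\cap\mathbf C_-=\{0\}$. We only consider cone pairs with $\mathbb R^{d_s}\times\{0\}\subset\mathbf C_-$. For a constant $C_{\mathcal F}\ge1$,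 let $\mathcal F(\mathbf C_+)=\mathcal F(\mathbf C_+,C_{\mathcal F})$ be the set of embedded $C^r$ submanifolds $\Gamma\subset\mathbb R^d$ of dimension $d_s$, with $C^r$ norms of submanifold charts and of their inverses bounded by $C_{\mathcal F}$ (the norms involve the derivatives of order at least $1$ and the Hölder constant of the derivative of order $\lfloor r\rfloor$, so that $\mathcal F(\mathbf C_+)$ is invariant under translations), such that the line through any two distinct points of $\Gamma$ is normal to a $d_u$-dimensional subspace contained in $\mathbf C_+$. Then $\pi_\Gamma=\pi_-|_\Gamma$ is injective. For $w\in\Gamma$ put $$\psi^{Op(\Gamma)}_{n}(f)(w)=\frac1{(2\pi)^{d_s}}\int_{\mathbb R^{d_s}}\int_{\mathbb R^{d_s}}e^{i(\pi_\Gamma(w)-z)\eta}\,\psi_n(\eta)\,f(\pi_\Gamma^{-1}(z))\,d\eta\,dz ,$$ where $\psi_n$ is the function on $\mathbb R^{d_s}$ and $f\circ\pi_\Gamma^{-1}$ is extended by $0$ outside $\pi_-(\Gamma)$. With $\mu_\Gamma$ the Riemannian volume of $\Gamma$, for $1\le p\le\infty$ and real $t,s$, put $$\|\varphi\|_{\mathcal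 U_p^{\mathbf C_\pm,t,s}}=\sup_{\Gamma\in\mathcal F(\mathbf C_+)}\ \sup_{\ell\ge0}\ \sup_{n\ge0}\ 2^{\ell t}\,2^{ns}\,\bigl\|\psi^{Op(\Gamma)}_{n}(\psi_\ell^{Op}\varphi)\bigr\|_{L_p(\mu_\Gamma)} .$$ For compact $K\subset\mathbb R^d$, $C^\infty(K)$ is the space of $C^\infty$ functions $\mathbb R^d\to\mathbb C$ supported in $K$, and $\mathcal U_p^{\mathbf C_\pm,t,s}(K)$ is its completion for this norm. For $\phi\in C^\infty(K)$ let $$\mathcal R_{n}(\varphi)=\phi\cdot\sum_{m\le n}\psi_m^{Op}(\varphi).$$ **Lemma (approximation by finite rank operators).** Let $K\subset\mathbb R^d$ be compact, let $1\le p\le\infty$ and $s\le -t\le 0$, let $\mathbf C_\pm$ and $\mathbf C'_\pm$ be arbitrary cone pairs as above (each with its own constant $C_{\mathcal F}$), and let $\phi\in C^\infty(K)$. Then every $\mathcal R_{n}$ extends to a bounded operator from $\mathcal U_p^{\mathbf C_\pm,t,s}(K)$ to $\mathcal U_p^{\mathbf C'_\pm,t,s}(K)$, and for each $v>0$ there is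 a constant $C_v$ such that for all integers $n_1\ge n_0\ge1$ there is a bounded operator $\mathcal T_{n_1}:\mathcal U_p^{\mathbf C_\pm,t,s}(K)\to\mathcal U_p^{\mathbf C'_\pm,t,s}(K)$ (which may depend on $n_0$) of rank at most $$\max\{1,\operatorname{diam}(K)/16\}^d\cdot 2^{d(n_1+5)}$$ (hence at most $2^{d(n_1+5)}$ if $\operatorname{diam}(K)\le16$), with $$\|(\mathcal R_{n_0}-\mathcal T_{n_1})\varphi\|_{\mathcal U_p^{\mathbf C'_\pm,t,s}(K)}\le C_v\,2^{-dvn_1}\,\|\varphi\|_{\mathcal U_p^{\mathbf C_\pm,t,s}(K)}\qquad\text{for all }\varphi\in\mathcal U_p^{\mathbf C_\pm,t,s}(K).$$ -/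

import Mathlib

set_option linter.unusedSectionVars false
set_option linter.unusedVariables false

open MeasureTheory
open scoped SchwartzMap ContDiff ENNReal

noncomputable section

namespace AnisoU

/-! ### Paley-Littlewood decomposition -/

/-- A `C^∞` cut-off `χ` with values in `[0,1]`, equal to `1` for `x ≤ 1` and to `0` for `x ≥ 2`.
(It is only evaluated on `[0,∞)`; being `1` on `[0,1]` it is extended by `1` to the left.) -/
structure Cutoff where
  toFun : ℝ → ℝ
  smooth : ContDiff ℝ ∞ toFun
  mem_Icc : ∀ x, toFun x ∈ Set.Icc (0 : ℝ) 1
  eq_one : ∀ x, x ≤ 1 → toFun x = 1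
  eq_zero : ∀ x, 2 ≤ x → toFun x = 0

section LP

variable {V : Type*} [NormedAddCommGroup V] [InnerProductSpace ℝ V]

/-- `ψ_0(ξ) = χ(‖ξ‖)` and `ψ_n(ξ) = χ(2^{-n}‖ξ‖) - χ(2^{-n+1}‖ξ‖)` for `n ≥ 1`. -/
def lpSymbol (χ : Cutoff) (n : ℕ) (ξ : V) : ℝ :=
  if n = 0 then χ.toFun ‖ξ‖
  else χ.toFun ((2 : ℝ) ^ (-(n : ℤ)) * ‖ξ‖) - χ.toFun ((2 : ℝ) ^ (-(n : ℤ) + 1) * ‖ξ‖)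

variable [FiniteDimensional ℝ V] [MeasurableSpace V] [BorelSpace V]

/-- The inverse Fourier transform `(2π)^{-dim V} ∫ e^{i⟨x,ξ⟩} a(ξ) dξ` of a symbol `a`. -/
def invFourier (a : V → ℝ) (x : V) : ℂ :=
  ((2 * Real.pi : ℝ) : ℂ) ^ (-(Module.finrank ℝ V : ℤ)) *
    ∫ ξ : V, Complex.exp (Complex.I * (inner ℝ x ξ : ℝ)) * (a ξ : ℂ)

/-- The operator `ψ_n^{Op} φ = 𝔽⁻¹(ψ_n · 𝔽 φ)` on rapidly decreasing functions. Mathlib's Fourier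
transform is `𝓕 φ(ζ) = ∫ e^{-2πi⟨x,ζ⟩} φ(x) dx`, so that the frequency `ξ` is `2πζ`; see
`lpOp_apply` for the formula `ψ_n^{Op} φ = (𝔽⁻¹ψ_n) * φ`. -/
def lpOp (χ : Cutoff) (n : ℕ) : 𝓢(V, ℂ) →L[ℂ] 𝓢(V, ℂ) :=
  SchwartzMap.fourierMultiplierCLM ℂ
    (fun ζ : V => ((lpSymbol χ n ((2 * Real.pi) • ζ) : ℝ) : ℂ))


theorem contDiff_cutoff (χ : Cutoff) {c : ℝ} (hc : 0 < c) :
    ContDiff ℝ ∞ (fun ξ : V => χ.toFun (c * ‖ξ‖)) := by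
  rw [contDiff_iff_contDiffAt]
  intro ξ
  by_cases h : ξ = 0
  · subst h
    have : (fun ξ : V => χ.toFun (c * ‖ξ‖)) =ᶠ[nhds 0] fun _ => (1 : ℝ) := by
      have ho : IsOpen {ξ : V | c * ‖ξ‖ < 1} := isOpen_lt (by fun_prop) (by fun_prop)
      filter_upwards [ho.mem_nhds (by simp)] with ξ hξ
      exact χ.eq_one _ (le_of_lt hξ)
    exact contDiffAt_const.congr_of_eventuallyEq this
  · exact χ.smooth.contDiffAt.comp ξ (contDiffAt_const.mul (contDiffAt_id.norm ℝ h))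

theorem hasCompactSupport_cutoff (χ : Cutoff) {c : ℝ} (hc : 0 < c) :
    HasCompactSupport (fun ξ : V => χ.toFun (c * ‖ξ‖)) := by
  refine HasCompactSupport.intro (isCompact_closedBall (0 : V) (2 / c)) fun ξ hξ => ?_
  have : 2 / c < ‖ξ‖ := by simpa using hξ
  exact χ.eq_zero _ (by rw [div_lt_iff₀ hc] at this; linarith)

/-- The symbol `(χ(‖ξ‖) - χ(2‖ξ‖)) / ‖ξ‖^{2M}`. -/
def ringSymbol (χ : Cutoff) (M : ℕ) (ξ : V) : ℝ :=
  (χ.toFun ‖ξ‖ - χ.toFun (2 * ‖ξ‖)) * ((‖ξ‖ ^ 2) ^ M)⁻¹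

theorem contDiff_ringSymbol (χ : Cutoff) (M : ℕ) :
    ContDiff ℝ ∞ (fun ξ : V => ringSymbol χ M ξ) := by
  rw [contDiff_iff_contDiffAt]
  intro ξ
  by_cases h : ξ = 0
  · subst h
    have : (fun ξ : V => ringSymbol χ M ξ) =ᶠ[nhds 0] fun _ => (0 : ℝ) := by
      have ho : IsOpen {ξ : V | 2 * ‖ξ‖ < 1} := isOpen_lt (by fun_prop) (by fun_prop)
      filter_upwards [ho.mem_nhds (by simp)] with ξ hξ
      have hξ' : 2 * ‖ξ‖ < 1 := hξ
      rw [ringSymbol, χ.eq_one _ hξ'.le, χ.eq_one _ (by nlinarith [norm_nonneg ξ])]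
      simp
    exact contDiffAt_const.congr_of_eventuallyEq this
  · have h1 := contDiff_cutoff (V := V) χ one_pos
    have h2 := contDiff_cutoff (V := V) χ two_pos
    simp only [one_mul] at h1
    refine (h1.contDiffAt.sub h2.contDiffAt).mul (ContDiffAt.inv ?_ ?_)
    · exact ((contDiff_norm_sq ℝ).pow M).contDiffAt
    · exact pow_ne_zero _ (pow_ne_zero _ (norm_ne_zero_iff.2 h))

theorem hasCompactSupport_ringSymbol (χ : Cutoff) (M : ℕ) :
    HasCompactSupport (fun ξ : V => ringSymbol χ M ξ) := by
  have h1 := hasCompactSupport_cutoff (V := V) χ one_pos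
  have h2 := hasCompactSupport_cutoff (V := V) χ two_pos
  simp only [one_mul] at h1
  exact (h1.sub h2).mul_right

theorem lpSymbol_zero (χ : Cutoff) (ξ : V) : lpSymbol χ 0 ξ = χ.toFun (1 * ‖ξ‖) := by
  simp [lpSymbol]

theorem lpSymbol_eq (χ : Cutoff) {n : ℕ} (hn : n ≠ 0) (M : ℕ) (ξ : V) :
    lpSymbol χ n ξ = ((4 : ℝ) ^ n)⁻¹ ^ M * (ringSymbol χ M (((2 : ℝ) ^ n)⁻¹ • ξ) *
      (‖ξ‖ ^ 2) ^ M) := by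
  rw [lpSymbol, if_neg hn, ringSymbol, norm_smul, Real.norm_of_nonneg (by positivity)]
  have e1 : (2 : ℝ) ^ (-(n : ℤ)) = ((2 : ℝ) ^ n)⁻¹ := by simp
  have e2 : (2 : ℝ) ^ (-(n : ℤ) + 1) * ‖ξ‖ = 2 * (((2 : ℝ) ^ n)⁻¹ * ‖ξ‖) := by
    rw [zpow_add₀ two_ne_zero, e1]; ring
  rw [e1, e2]
  by_cases h : ‖ξ‖ = 0
  · simp [h]
  · have : (4 : ℝ) ^ n = ((2 : ℝ) ^ n) ^ 2 := by
      rw [← pow_mul, mul_comm, pow_mul]; norm_num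
    rw [this]
    field_simp
    rw [mul_assoc, ← mul_pow]
    congr 2
    ring

theorem contDiff_lpSymbol (χ : Cutoff) (n : ℕ) :
    ContDiff ℝ ∞ (fun ξ : V => lpSymbol χ n ξ) := by
  unfold lpSymbol
  split_ifs with h
  · simpa using contDiff_cutoff (V := V) χ one_pos
  · exact (contDiff_cutoff χ (by positivity)).sub (contDiff_cutoff χ (by positivity))

theorem hasCompactSupport_lpSymbol (χ : Cutoff) (n : ℕ) :
    HasCompactSupport (fun ξ : V => lpSymbol χ n ξ) := by
  unfold lpSymbol
  split_ifs with h
  · simpa using hasCompactSupport_cutoff (V := V) χ one_pos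
  · exact (hasCompactSupport_cutoff χ (by positivity)).sub
      (hasCompactSupport_cutoff χ (by positivity))

theorem invFourier_eq (a : V → ℝ) (x : V) :
    invFourier a x = FourierTransformInv.fourierInv
      (fun ζ : V => ((a ((2 * Real.pi) • ζ) : ℝ) : ℂ)) x := by
  have hp : (0 : ℝ) < 2 * Real.pi := by positivity
  rw [Real.fourierInv_eq', invFourier]
  have := Measure.integral_comp_smul (volume : Measure V)
    (fun ξ : V => Complex.exp (Complex.I * (inner ℝ x ξ : ℝ)) * (a ξ : ℂ)) (2 * Real.pi)
  have e : ∀ v : V, Complex.exp (Complex.I * ((inner ℝ x ((2 * Real.pi) • v) : ℝ) : ℂ)) *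
      ((a ((2 * Real.pi) • v) : ℝ) : ℂ) =
      Complex.exp ((2 * Real.pi * inner ℝ v x : ℝ) * Complex.I) •
        ((a ((2 * Real.pi) • v) : ℝ) : ℂ) := by
    intro v
    rw [inner_smul_right, real_inner_comm x v, smul_eq_mul, mul_comm Complex.I]
  simp only [e] at this
  rw [this, abs_of_pos (by positivity), Complex.real_smul]
  congr 1
  push_cast
  simp

/-- The symbol `a` in Mathlib's frequency variable, as a Schwartz function. -/
def symbolS (a : V → ℝ) (h1 : HasCompactSupport a) (h2 : ContDiff ℝ ∞ a) : 𝓢(V, ℂ) :=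
  HasCompactSupport.toSchwartzMap (f := fun ζ : V => ((a ((2 * Real.pi) • ζ) : ℝ) : ℂ))
    (by
      have := h1.comp_homeomorph (Homeomorph.smulOfNeZero (2 * Real.pi) (by positivity))
      exact this.comp_left (g := fun x : ℝ => (x : ℂ)) (by simp))
    (Complex.ofRealCLM.contDiff.comp (h2.comp (by fun_prop)))

theorem invFourier_eq_schwartz (a : V → ℝ) (h1 : HasCompactSupport a) (h2 : ContDiff ℝ ∞ a)
    (x : V) : invFourier a x = (FourierTransformInv.fourierInv (symbolS a h1 h2) : 𝓢(V, ℂ)) x := by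
  rw [invFourier_eq, SchwartzMap.fourierInv_coe]
  rfl

theorem multiplier_apply (a : V → ℝ) (h1 : HasCompactSupport a) (h2 : ContDiff ℝ ∞ a)
    (f : 𝓢(V, ℂ)) (x : V) :
    SchwartzMap.fourierMultiplierCLM ℂ (fun ζ : V => ((a ((2 * Real.pi) • ζ) : ℝ) : ℂ)) f x =
      ∫ y, invFourier a (x - y) * f y := by
  set k : 𝓢(V, ℂ) := FourierTransformInv.fourierInv (symbolS a h1 h2)
  have hg : Function.HasTemperateGrowth (fun ζ : V => ((a ((2 * Real.pi) • ζ) : ℝ) : ℂ)) :=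
    (symbolS a h1 h2).hasTemperateGrowth
  have key : SchwartzMap.fourierMultiplierCLM ℂ
      (fun ζ : V => ((a ((2 * Real.pi) • ζ) : ℝ) : ℂ)) f =
      SchwartzMap.convolution (ContinuousLinearMap.mul ℂ ℂ) k f := by
    have hfour : FourierTransform.fourier (SchwartzMap.convolution (ContinuousLinearMap.mul ℂ ℂ) k f)
        = SchwartzMap.smulLeftCLM ℂ (fun ζ : V => ((a ((2 * Real.pi) • ζ) : ℝ) : ℂ))
          (FourierTransform.fourier f) := by
      rw [SchwartzMap.fourier_convolution]
      ext ζ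
      rw [SchwartzMap.smulLeftCLM_apply_apply hg]
      simp only [k, FourierTransform.fourier_fourierInv_eq]
      rw [SchwartzMap.pairing_apply_apply]
      rfl
    rw [SchwartzMap.fourierMultiplierCLM_apply, ← hfour, FourierTransform.fourierInv_fourier_eq]
  rw [key, SchwartzMap.convolution_apply]
  rw [convolution_eq_swap]
  simp [k, invFourier_eq_schwartz a h1 h2]

theorem lpOp_apply (χ : Cutoff) (n : ℕ) (f : 𝓢(V, ℂ)) (x : V) :
    lpOp χ n f x = ∫ y, invFourier (lpSymbol χ n) (x - y) * f y :=
  multiplier_apply _ (hasCompactSupport_lpSymbol χ n) (contDiff_lpSymbol χ n) f x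

theorem invFourier_dilate (a : V → ℝ) {c : ℝ} (hc : 0 < c) (x : V) :
    invFourier (fun ξ => a (c⁻¹ • ξ)) x =
      ((c ^ Module.finrank ℝ V : ℝ) : ℂ) * invFourier a (c • x) := by
  have := Measure.integral_comp_smul (volume : Measure V)
    (fun ξ : V => Complex.exp (Complex.I * (inner ℝ x (c • ξ) : ℝ)) * (a ξ : ℂ)) c⁻¹
  have e : ∀ v : V, c • c⁻¹ • v = v := fun v => by rw [smul_smul, mul_inv_cancel₀ hc.ne', one_smul]
  simp only [e] at this
  rw [invFourier, invFourier, this, abs_of_pos (by positivity), Complex.real_smul]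
  simp only [real_inner_smul_left, real_inner_smul_right]
  push_cast
  simp only [inv_pow, inv_inv]
  ring

/-- The weighted mass of a kernel. -/
def kerMass (a : V → ℝ) (N : ℕ) : ℝ := ∫ v : V, ‖invFourier a v‖ * (1 + ‖v‖) ^ N

theorem integrable_kerMass (a : V → ℝ) (h1 : HasCompactSupport a) (h2 : ContDiff ℝ ∞ a) (N : ℕ) :
    Integrable (fun v : V => ‖invFourier a v‖ * (1 + ‖v‖) ^ N) := by
  set k : 𝓢(V, ℂ) := FourierTransformInv.fourierInv (symbolS a h1 h2) with hk
  have : (fun v : V => ‖invFourier a v‖ * (1 + ‖v‖) ^ N) =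
      fun v => ∑ j ∈ Finset.range (N + 1), (N.choose j : ℝ) * (‖v‖ ^ j * ‖k v‖) := by
    ext v
    rw [invFourier_eq_schwartz a h1 h2, add_comm, add_pow, Finset.mul_sum]
    refine Finset.sum_congr rfl fun j _ => ?_
    simp only [one_pow, mul_one, ← hk]
    ring
  rw [this]
  exact integrable_finsetSum _ fun j _ => (k.integrable_pow_mul volume j).const_mul _

/-- Dilated kernels preserve decay, uniformly in the scale. -/
theorem kernel_decay (a : V → ℝ) (h1 : HasCompactSupport a) (h2 : ContDiff ℝ ∞ a) (N : ℕ)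
    {c : ℝ} (hc : 1 ≤ c) {f : V → ℂ} {H : ℝ} (hH : 0 ≤ H)
    (hf : ∀ y, ‖f y‖ * (1 + ‖y‖) ^ N ≤ H) (x : V) :
    ‖∫ y, invFourier (fun ξ => a (c⁻¹ • ξ)) (x - y) * f y‖ * (1 + ‖x‖) ^ N ≤
      kerMass a N * H := by
  have hc0 : 0 < c := by linarith
  set m := Module.finrank ℝ V
  set g : V → ℝ := fun v => ‖invFourier a v‖ * (1 + ‖v‖) ^ N with hg
  have hgi : Integrable g := integrable_kerMass a h1 h2 N
  set G : V → ℝ := fun y => H * (c ^ m * g (c • (x - y))) with hG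
  have hGi : Integrable G :=
    (((hgi.comp_smul hc0.ne').comp_sub_left x).const_mul _).const_mul _
  have hGv : ∫ y, G y = H * kerMass a N := by
    rw [hG, integral_const_mul, integral_const_mul,
      integral_sub_left_eq_self (fun z => g (c • z)) volume x, Measure.integral_comp_smul,
      abs_of_pos (by positivity), smul_eq_mul, ← mul_assoc (c ^ m), mul_inv_cancel₀ (by positivity),
      one_mul]
    rfl
  have hpt : ∀ y, ‖(((1 + ‖x‖) ^ N : ℝ) : ℂ) *
      (invFourier (fun ξ => a (c⁻¹ • ξ)) (x - y) * f y)‖ ≤ G y := by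
    intro y
    rw [norm_mul, norm_mul, invFourier_dilate a hc0, norm_mul, Complex.norm_real,
      Complex.norm_real, Real.norm_of_nonneg (by positivity), Real.norm_of_nonneg (by positivity)]
    have hx : (1 + ‖x‖) ^ N ≤ (1 + ‖c • (x - y)‖) ^ N * (1 + ‖y‖) ^ N := by
      rw [← mul_pow]
      refine pow_le_pow_left₀ (by positivity) ?_ N
      have h3 : ‖x‖ ≤ ‖x - y‖ + ‖y‖ := by simpa using norm_add_le (x - y) y
      have h4 : ‖x - y‖ ≤ ‖c • (x - y)‖ := by
        rw [norm_smul, Real.norm_of_nonneg hc0.le]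
        nlinarith [norm_nonneg (x - y)]
      nlinarith [norm_nonneg y, norm_nonneg (c • (x - y))]
    calc (1 + ‖x‖) ^ N * (c ^ m * ‖invFourier a (c • (x - y))‖ * ‖f y‖)
        ≤ ((1 + ‖c • (x - y)‖) ^ N * (1 + ‖y‖) ^ N) *
          (c ^ m * ‖invFourier a (c • (x - y))‖ * ‖f y‖) := by gcongr
      _ = (‖f y‖ * (1 + ‖y‖) ^ N) * (c ^ m * (‖invFourier a (c • (x - y))‖ *
          (1 + ‖c • (x - y)‖) ^ N)) := by ring
      _ ≤ G y := by
          simp only [hG, hg]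
          gcongr
          exact hf y
  have := norm_integral_le_of_norm_le hGi (Filter.Eventually.of_forall hpt)
  rw [integral_const_mul, norm_mul, Complex.norm_real, Real.norm_of_nonneg (by positivity), hGv]
    at this
  linarith

theorem kerMass_nonneg (a : V → ℝ) (N : ℕ) : 0 ≤ kerMass a N :=
  integral_nonneg fun v => by positivity

/-- Littlewood-Paley kernels preserve polynomial decay, uniformly in the index. -/
theorem lpKernel_decay (χ : Cutoff) (N : ℕ) :
    ∃ B : ℝ, 0 ≤ B ∧ ∀ (n : ℕ) (f : V → ℂ) (H : ℝ), 0 ≤ H →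
      (∀ y, ‖f y‖ * (1 + ‖y‖) ^ N ≤ H) →
      ∀ x, ‖∫ y, invFourier (lpSymbol χ n) (x - y) * f y‖ * (1 + ‖x‖) ^ N ≤ B * H := by
  refine ⟨kerMass (V := V) (lpSymbol χ 0) N + kerMass (V := V) (ringSymbol χ 0) N,
    add_nonneg (kerMass_nonneg _ _) (kerMass_nonneg _ _), fun n f H hH hf x => ?_⟩
  rcases Nat.eq_zero_or_pos n with rfl | hn
  · have := kernel_decay (V := V) (lpSymbol χ 0) (hasCompactSupport_lpSymbol χ 0)
      (contDiff_lpSymbol χ 0) N le_rfl hH hf x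
    simp only [inv_one, one_smul] at this
    nlinarith [kerMass_nonneg (V := V) (ringSymbol χ 0) N]
  · have := kernel_decay (V := V) (ringSymbol χ 0) (hasCompactSupport_ringSymbol χ 0)
      (contDiff_ringSymbol χ 0) N (c := 2 ^ n) (one_le_pow₀ one_le_two) hH hf x
    have e : lpSymbol (V := V) χ n = fun ξ => ringSymbol χ 0 (((2 : ℝ) ^ n)⁻¹ • ξ) := by
      ext ξ; rw [lpSymbol_eq χ hn.ne' 0]; simp
    rw [e]
    nlinarith [kerMass_nonneg (V := V) (lpSymbol χ 0) N]

theorem schwartz_decay (f : 𝓢(V, ℂ)) (N : ℕ) : ∃ H : ℝ, 0 ≤ H ∧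
    ∀ y, ‖f y‖ * (1 + ‖y‖) ^ N ≤ H := by
  refine ⟨2 ^ N * ((Finset.Iic (N, 0)).sup fun m => SchwartzMap.seminorm ℝ m.1 m.2) f,
    by positivity, fun y => ?_⟩
  have := SchwartzMap.one_add_le_sup_seminorm_apply (𝕜 := ℝ) (m := (N, 0)) le_rfl le_rfl f y
  simpa [mul_comm] using this

/-- The pieces `ψ_n^{Op} φ` of a Schwartz function decay faster than any `2^{-tn}`. -/
theorem lpOp_decay (χ : Cutoff) (t : ℝ) (N : ℕ) (f : 𝓢(V, ℂ)) :
    ∃ H : ℝ, 0 ≤ H ∧ ∀ (n : ℕ) (x : V),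
      (2 : ℝ) ^ ((n : ℝ) * t) * ‖lpOp χ n f x‖ * (1 + ‖x‖) ^ N ≤ H := by
  obtain ⟨M, hM⟩ := exists_nat_ge t
  set q : V → ℂ := fun ζ => (((‖(2 * Real.pi) • ζ‖ ^ 2) ^ M : ℝ) : ℂ) with hq
  have hqg : q.HasTemperateGrowth := by
    have : q = fun ζ => (((2 * Real.pi) ^ 2) ^ M : ℂ) * (((‖ζ‖ ^ 2 : ℝ) : ℂ) ^ M) := by
      ext ζ
      simp only [hq, norm_smul, Real.norm_of_nonneg (show (0 : ℝ) ≤ 2 * Real.pi by positivity)]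
      push_cast
      ring
    rw [this]
    fun_prop
  set g : 𝓢(V, ℂ) := SchwartzMap.fourierMultiplierCLM ℂ q f
  obtain ⟨H0, hH0, h0⟩ := schwartz_decay f N
  obtain ⟨H1, hH1, h1⟩ := schwartz_decay g N
  have hK := kerMass_nonneg (V := V) (lpSymbol χ 0) N
  have hK' := kerMass_nonneg (V := V) (ringSymbol χ M) N
  refine ⟨kerMass (V := V) (lpSymbol χ 0) N * H0 + kerMass (V := V) (ringSymbol χ M) N * H1,
    by positivity, fun n x => ?_⟩
  rcases Nat.eq_zero_or_pos n with rfl | hn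
  · have := kernel_decay (V := V) (lpSymbol χ 0) (hasCompactSupport_lpSymbol χ 0)
      (contDiff_lpSymbol χ 0) N le_rfl hH0 h0 x
    simp only [inv_one, one_smul] at this
    rw [lpOp_apply]
    simp only [Nat.cast_zero, zero_mul, Real.rpow_zero, one_mul]
    nlinarith [mul_nonneg hK' hH1]
  · have hd := kernel_decay (V := V) (ringSymbol χ M) (hasCompactSupport_ringSymbol χ M)
      (contDiff_ringSymbol χ M) N (c := 2 ^ n) (one_le_pow₀ one_le_two) hH1 h1 x
    set b : V → ℝ := fun ξ => ringSymbol χ M (((2 : ℝ) ^ n)⁻¹ • ξ) with hb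
    have hb1 : HasCompactSupport b := (hasCompactSupport_ringSymbol χ M).comp_homeomorph
      (Homeomorph.smulOfNeZero (((2 : ℝ) ^ n)⁻¹) (by positivity))
    have hb2 : ContDiff ℝ ∞ b := (contDiff_ringSymbol χ M).comp (by fun_prop)
    rw [← multiplier_apply b hb1 hb2] at hd
    have hbg : Function.HasTemperateGrowth (fun ζ : V => ((b ((2 * Real.pi) • ζ) : ℝ) : ℂ)) :=
      (symbolS b hb1 hb2).hasTemperateGrowth
    rw [SchwartzMap.fourierMultiplierCLM_fourierMultiplierCLM_apply hbg hqg] at hd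
    have e : (fun ζ : V => ((lpSymbol χ n ((2 * Real.pi) • ζ) : ℝ) : ℂ)) =
        (((((4 : ℝ) ^ n)⁻¹ ^ M : ℝ) : ℂ)) •
          ((fun ζ : V => ((b ((2 * Real.pi) • ζ) : ℝ) : ℂ)) * q) := by
      ext ζ
      rw [lpSymbol_eq χ hn.ne' M]
      simp [hq, hb]
    have e2 : lpOp χ n f x = (((((4 : ℝ) ^ n)⁻¹ ^ M : ℝ) : ℂ)) *
        SchwartzMap.fourierMultiplierCLM ℂ
          ((fun ζ : V => ((b ((2 * Real.pi) • ζ) : ℝ) : ℂ)) * q) f x := by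
      rw [lpOp, e, SchwartzMap.fourierMultiplierCLM_smul (hbg.mul hqg)]
      rfl
    rw [e2, norm_mul, Complex.norm_real, Real.norm_of_nonneg (by positivity)]
    have e3 : (2 : ℝ) ^ ((n : ℝ) * t) * ((4 : ℝ) ^ n)⁻¹ ^ M ≤ 1 := by
      have a1 : (2 : ℝ) ^ ((n : ℝ) * t) ≤ (2 : ℝ) ^ ((n * M : ℕ) : ℝ) := by
        apply Real.rpow_le_rpow_of_exponent_le one_le_two
        push_cast
        gcongr
      rw [Real.rpow_natCast, pow_mul] at a1
      have a2 : ((2 : ℝ) ^ n) ^ M ≤ ((4 : ℝ) ^ n) ^ M := by gcongr; norm_num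
      rw [inv_pow, ← div_eq_mul_inv, div_le_one (by positivity)]
      exact a1.trans a2
    have hn0 := norm_nonneg (SchwartzMap.fourierMultiplierCLM ℂ
          ((fun ζ : V => ((b ((2 * Real.pi) • ζ) : ℝ) : ℂ)) * q) f x)
    calc _ = ((2 : ℝ) ^ ((n : ℝ) * t) * ((4 : ℝ) ^ n)⁻¹ ^ M) *
          (‖SchwartzMap.fourierMultiplierCLM ℂ
          ((fun ζ : V => ((b ((2 * Real.pi) • ζ) : ℝ) : ℂ)) * q) f x‖ * (1 + ‖x‖) ^ N) := by ring
      _ ≤ 1 * (‖SchwartzMap.fourierMultiplierCLM ℂ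
          ((fun ζ : V => ((b ((2 * Real.pi) • ζ) : ℝ) : ℂ)) * q) f x‖ * (1 + ‖x‖) ^ N) := by
          gcongr
      _ ≤ _ := by rw [one_mul]; nlinarith [mul_nonneg hK hH0]

end LP

/-! ### Cone pairs -/

/-- `ℝ^d = ℝ^{d_s} × ℝ^{d_u}` with its Euclidean structure. -/
abbrev Ambient (ds du : ℕ) := EuclideanSpace ℝ (Fin ds ⊕ Fin du)

/-- The orthogonal projection `π_- : ℝ^d → ℝ^{d_s}`. -/
def projS (ds du : ℕ) : Ambient ds du →ₗ[ℝ] EuclideanSpace ℝ (Fin ds) where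
  toFun x := WithLp.toLp 2 fun i => x (Sum.inl i)
  map_add' _ _ := rfl
  map_smul' _ _ := rfl

/-- The orthogonal projection `π_+ : ℝ^d → ℝ^{d_u}`. -/
def projU (ds du : ℕ) : Ambient ds du →ₗ[ℝ] EuclideanSpace ℝ (Fin du) where
  toFun x := WithLp.toLp 2 fun i => x (Sum.inr i)
  map_add' _ _ := rfl
  map_smul' _ _ := rfl

/-- A cone is a subset invariant under scalar multiplication. -/
def IsCone {V : Type*} [AddCommGroup V] [Module ℝ V] (C : Set V) : Prop :=
  ∀ (c : ℝ), ∀ x ∈ C, c • x ∈ C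

/-- `C` is `k`-dimensional: `k ≥ 1` is the maximal dimension of a linear subset of `C`. -/
def HasConeDim {V : Type*} [AddCommGroup V] [Module ℝ V] (C : Set V) (k : ℕ) : Prop :=
  1 ≤ k ∧ IsGreatest {j : ℕ | ∃ L : Submodule ℝ V, (L : Set V) ⊆ C ∧ Module.finrank ℝ L = j} k

/-- Cone pairs `(C_+, C_-)`. -/
structure ConePair (ds du : ℕ) where
  plus : Set (Ambient ds du)
  minus : Set (Ambient ds du)
  isCone_plus : IsCone plus
  isCone_minus : IsCone minus
  isClosed_plus : IsClosed plus
  isClosed_minus : IsClosed minus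
  interior_plus : (interior plus).Nonempty
  interior_minus : (interior minus).Nonempty
  dim_plus : HasConeDim plus du
  dim_minus : HasConeDim minus ds
  inter_eq : plus ∩ minus = {0}

/-- `ℝ^{d_s} × {0}` is included in `C_-`. -/
def ConePair.HorizontalSubset {ds du : ℕ} (C : ConePair ds du) : Prop :=
  ∀ x : Ambient ds du, projU ds du x = 0 → x ∈ C.minus

/-! ### Fake stable leaves -/

/-- `f` is `C^r` on the open set `U`, with derivatives of orders `1, …, ⌊r⌋` bounded by `c` and,
if `r` is not an integer, with `⌊r⌋`-th derivative `(r - ⌊r⌋)`-Hölder with constant `c`. Values of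
`f` itself are not bounded, so that the notion is invariant under translations. -/
structure CrBound {V W : Type*} [NormedAddCommGroup V] [NormedSpace ℝ V] [NormedAddCommGroup W]
    [NormedSpace ℝ W] (r c : ℝ) (f : V → W) (U : Set V) : Prop where
  contDiffOn : ContDiffOn ℝ (⌊r⌋₊ : ℕ) f U
  bound : ∀ j : ℕ, 1 ≤ j → j ≤ ⌊r⌋₊ → ∀ x ∈ U, ‖iteratedFDeriv ℝ j f x‖ ≤ c
  holder : (⌊r⌋₊ : ℝ) < r → ∀ x ∈ U, ∀ y ∈ U,
    ‖iteratedFDeriv ℝ ⌊r⌋₊ f x - iteratedFDeriv ℝ ⌊r⌋₊ f y‖ ≤ c * ‖x - y‖ ^ (r - ⌊r⌋₊)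

/-- `Γ` belongs to `𝓕(C_+, C_𝓕)`: it is an embedded `C^r` submanifold of `ℝ^d` of dimension `d_s`,
having at each point a submanifold chart `e` which together with its inverse has `C^r` norm at most
`CF`, and the line through any two distinct points of `Γ` is normal to a `d_u`-dimensional subspace
contained in `C_+`. -/
structure IsFakeLeaf {ds du : ℕ} (r : ℝ) (Cplus : Set (Ambient ds du)) (CF : ℝ)
    (Γ : Set (Ambient ds du)) : Prop where
  chart : ∀ w ∈ Γ, ∃ e : OpenPartialHomeomorph (Ambient ds du) (Ambient ds du),
    w ∈ e.source ∧ (∀ x ∈ e.source, x ∈ Γ ↔ projU ds du (e x) = 0) ∧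
    CrBound r CF e e.source ∧ CrBound r CF e.symm e.target
  normal : ∀ x ∈ Γ, ∀ y ∈ Γ, x ≠ y → ∃ L : Submodule ℝ (Ambient ds du),
    Module.finrank ℝ L = du ∧ (L : Set (Ambient ds du)) ⊆ Cplus ∧
    ∀ l ∈ L, inner ℝ (x - y) l = 0

open Classical in
/-- `f ∘ π_Γ⁻¹` on `ℝ^{d_s}`, where `π_Γ` is the restriction of `π_-` to `Γ` (injective for fake
stable leaves), extended by `0` outside of `π_-(Γ)`. -/
def leafPull {ds du : ℕ} (Γ : Set (Ambient ds du)) (f : Ambient ds du → ℂ)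
    (z : EuclideanSpace ℝ (Fin ds)) : ℂ :=
  if h : ∃ w ∈ Γ, projS ds du w = z then f h.choose else 0

/-- The operator `ψ_n^{Op(Γ)}`: at `w ∈ Γ` it is
`(2π)^{-d_s} ∫_z ∫_η e^{i⟨π_Γ(w) - z, η⟩} ψ_n^{(d_s)}(η) f(π_Γ⁻¹ z) dη dz`. -/
def leafOp {ds du : ℕ} (χ : Cutoff) (n : ℕ) (Γ : Set (Ambient ds du)) (f : Ambient ds du → ℂ)
    (w : Ambient ds du) : ℂ :=
  ∫ z : EuclideanSpace ℝ (Fin ds), invFourier (lpSymbol χ n) (projS ds du w - z) * leafPull Γ f z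

/-- The Riemannian volume of a `d_s`-dimensional submanifold `Γ` of `ℝ^d`: the `d_s`-dimensional
Hausdorff measure (normalized to agree with Lebesgue measure on `d_s`-planes) on `Γ`. -/
def leafMeasure {ds du : ℕ} (Γ : Set (Ambient ds du)) : Measure (Ambient ds du) :=
  (Measure.euclideanHausdorffMeasure ds).restrict Γ

/-- `‖f‖^s_{p,Γ} = sup_n 2^{ns} ‖ψ_n^{Op(Γ)} f‖_{L_p(μ_Γ)}`, as an extended real. -/
def leafNorm {ds du : ℕ} (χ : Cutoff) (p : ℝ≥0∞) (s : ℝ) (Γ : Set (Ambient ds du))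
    (f : Ambient ds du → ℂ) : ℝ≥0∞ :=
  ⨆ n : ℕ, ENNReal.ofReal ((2 : ℝ) ^ ((n : ℝ) * s)) * eLpNorm (leafOp χ n Γ f) p (leafMeasure Γ)

/-- `‖φ‖_{𝓤^{C_±,t,s}_p} = sup_Γ sup_ℓ 2^{ℓt} ‖ψ_ℓ^{Op} φ‖^s_{p,Γ}`, the first supremum being over
`Γ ∈ 𝓕(C_+, C_𝓕)`, as an extended real; it is finite by `uENorm_lt_top`. -/
def uENorm {ds du : ℕ} (χ : Cutoff) (r : ℝ) (C : ConePair ds du) (CF : ℝ) (p : ℝ≥0∞) (t s : ℝ)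
    (φ : 𝓢(Ambient ds du, ℂ)) : ℝ≥0∞ :=
  ⨆ (Γ : Set (Ambient ds du)) (_ : IsFakeLeaf r C.plus CF Γ) (l : ℕ),
    ENNReal.ofReal ((2 : ℝ) ^ ((l : ℝ) * t)) * leafNorm χ p s Γ (lpOp χ l φ)

section Leaves

variable {ds du : ℕ}

theorem norm_sq_eq_proj (x : Ambient ds du) :
    ‖x‖ ^ 2 = ‖projS ds du x‖ ^ 2 + ‖projU ds du x‖ ^ 2 := by
  simp only [EuclideanSpace.norm_sq_eq, Fintype.sum_sum_type]
  rfl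

theorem inner_eq_proj (x y : Ambient ds du) :
    inner ℝ x y = (inner ℝ (projS ds du x) (projS ds du y) : ℝ) +
      inner ℝ (projU ds du x) (projU ds du y) := by
  simp only [PiLp.inner_apply, Fintype.sum_sum_type]
  rfl

theorem norm_projS_le (x : Ambient ds du) : ‖projS ds du x‖ ≤ ‖x‖ := by
  have := norm_sq_eq_proj x
  exact le_of_sq_le_sq (by nlinarith [sq_nonneg ‖projU ds du x‖]) (norm_nonneg x)

theorem continuous_projS : Continuous (projS ds du) :=
  (projS ds du).continuous_of_finiteDimensional

theorem continuous_projU : Continuous (projU ds du) :=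
  (projU ds du).continuous_of_finiteDimensional

theorem ConePair.eq_zero_of_projU (C : ConePair ds du) (hC : C.HorizontalSubset)
    {x : Ambient ds du} (hx : x ∈ C.plus) (h : projU ds du x = 0) : x = 0 := by
  have : x ∈ C.plus ∩ C.minus := ⟨hx, hC x h⟩
  rw [C.inter_eq] at this
  exact this

/-- Vectors of `C_+` are uniformly transverse to the horizontal space. -/
theorem ConePair.exists_bound (C : ConePair ds du) (hC : C.HorizontalSubset) :
    ∃ A : ℝ, 0 ≤ A ∧ ∀ x ∈ C.plus, ‖x‖ ≤ A * ‖projU ds du x‖ := by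
  set S : Set (Ambient ds du) := C.plus ∩ Metric.sphere 0 1
  have hS : IsCompact S := (isCompact_sphere 0 1).inter_left C.isClosed_plus
  rcases S.eq_empty_or_nonempty with hE | hN
  · refine ⟨0, le_rfl, fun x hx => ?_⟩
    by_cases h : x = 0
    · simp [h]
    · exfalso
      have : ‖x‖⁻¹ • x ∈ S := ⟨C.isCone_plus _ _ hx, by
        simp [norm_smul, inv_mul_cancel₀ (norm_ne_zero_iff.2 h)]⟩
      rw [hE] at this
      exact this
  · obtain ⟨x0, hx0, hmin⟩ := hS.exists_isMinOn hN
      (continuous_projU (ds := ds) (du := du)).norm.continuousOn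
    have hpos : 0 < ‖projU ds du x0‖ := by
      rw [norm_pos_iff]
      intro h
      have := C.eq_zero_of_projU hC hx0.1 h
      have h1 := hx0.2
      simp [this] at h1
    refine ⟨‖projU ds du x0‖⁻¹, by positivity, fun x hx => ?_⟩
    by_cases h : x = 0
    · simp [h]
    · have hxn : 0 < ‖x‖ := norm_pos_iff.2 h
      have hm : ‖x‖⁻¹ • x ∈ S := ⟨C.isCone_plus _ _ hx, by
        simp [norm_smul, inv_mul_cancel₀ hxn.ne']⟩
      have := hmin hm
      simp only [Set.mem_ofPred_eq, map_smul, norm_smul, norm_inv, norm_norm] at this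
      rw [← div_eq_inv_mul, le_div_iff₀ hpos]
      rw [← div_eq_inv_mul, le_div_iff₀ hxn] at this
      linarith

/-- Fake stable leaves are uniformly Lipschitz graphs over `ℝ^{d_s}`. -/
theorem ConePair.exists_lipschitz (C : ConePair ds du) (hC : C.HorizontalSubset) :
    ∃ A : NNReal, ∀ (r CF : ℝ) (Γ : Set (Ambient ds du)), IsFakeLeaf r C.plus CF Γ →
      ∀ x ∈ Γ, ∀ y ∈ Γ, ‖x - y‖ ≤ A * ‖projS ds du x - projS ds du y‖ := by
  obtain ⟨A, hA, hb⟩ := C.exists_bound hC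
  refine ⟨⟨1 + A, by positivity⟩, fun r CF Γ hΓ x hx y hy => ?_⟩
  by_cases hxy : x = y
  · simp [hxy]
  obtain ⟨L, hL, hLC, hn⟩ := hΓ.normal x hx y hy hxy
  set v := x - y with hv
  have hinj : Function.Injective ((projU ds du).domRestrict L) := by
    rw [injective_iff_map_eq_zero]
    intro l hl
    exact Subtype.ext (C.eq_zero_of_projU hC (hLC l.2) hl)
  have hsurj : Function.Surjective ((projU ds du).domRestrict L) :=
    (LinearMap.injective_iff_surjective_of_finrank_eq_finrank (by simp [hL])).1 hinj
  obtain ⟨l, hl⟩ := hsurj (projU ds du v)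
  have hl' : projU ds du (l : Ambient ds du) = projU ds du v := hl
  have h1 := hn l l.2
  rw [inner_eq_proj, hl', real_inner_self_eq_norm_sq] at h1
  have h2 := abs_real_inner_le_norm (projS ds du v) (projS ds du (l : Ambient ds du))
  have h3 := hb l (hLC l.2)
  rw [hl'] at h3
  have h4 := norm_projS_le (l : Ambient ds du)
  have h5 : ‖projU ds du v‖ ^ 2 ≤ ‖projS ds du v‖ * (A * ‖projU ds du v‖) := by
    have : ‖projU ds du v‖ ^ 2 ≤ |inner ℝ (projS ds du v) (projS ds du (l : Ambient ds du))| := by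
      rw [show ‖projU ds du v‖ ^ 2 =
        -inner ℝ (projS ds du v) (projS ds du (l : Ambient ds du)) by linarith]
      exact neg_le_abs _
    refine this.trans (h2.trans ?_)
    gcongr
    exact h4.trans h3
  have h6 : ‖projU ds du v‖ ≤ A * ‖projS ds du v‖ := by
    rcases (norm_nonneg (projU ds du v)).eq_or_lt with h0 | h0
    · rw [← h0]; positivity
    · nlinarith
  have h7 : ‖v‖ ≤ ‖projS ds du v‖ + ‖projU ds du v‖ := by
    refine le_of_sq_le_sq ?_ (by positivity)
    rw [norm_sq_eq_proj]
    nlinarith [norm_nonneg (projS ds du v), norm_nonneg (projU ds du v)]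
  rw [← map_sub]
  change ‖v‖ ≤ (1 + A) * ‖projS ds du v‖
  linarith

theorem IsFakeLeaf.isLocallyClosed {r CF : ℝ} {Cp Γ : Set (Ambient ds du)}
    (h : IsFakeLeaf r Cp CF Γ) : IsLocallyClosed Γ := by
  refine ((isLocallyClosed_tfae Γ).out 0 3).2 fun w hw => ?_
  obtain ⟨e, hwe, he, -, -⟩ := h.chart w hw
  refine ⟨e.source, hwe, e.open_source, fun x hx => ?_⟩
  rw [he x hx.1]
  by_contra hne
  have ho : IsOpen (e.source ∩ e ⁻¹' {y | projU ds du y ≠ 0}) :=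
    e.isOpen_inter_preimage (isOpen_ne_fun continuous_projU continuous_const)
  obtain ⟨z, hz, hzΓ⟩ := mem_closure_iff.1 hx.2 _ ho ⟨hx.1, hne⟩
  exact hz.2 ((he z hz.1).1 hzΓ)

theorem isSigmaCompact_of_isLocallyClosed {Γ : Set (Ambient ds du)} (h : IsLocallyClosed Γ) :
    IsSigmaCompact Γ := by
  obtain ⟨U, Z, hU, hZ, rfl⟩ := h
  obtain ⟨F, hF, -, hFU, -⟩ := hU.exists_iUnion_isClosed
  rw [← hFU, Set.iUnion_inter]
  exact isSigmaCompact_iUnion _ fun n => isSigmaCompact_univ.of_isClosed_subset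
    ((hF n).inter hZ) (Set.subset_univ _)

theorem measurableSet_image_projS {Γ : Set (Ambient ds du)} (h : IsLocallyClosed Γ) :
    MeasurableSet (projS ds du '' Γ) := by
  obtain ⟨K, hK, hKe⟩ := (isSigmaCompact_of_isLocallyClosed h).image continuous_projS
  rw [← hKe]
  exact MeasurableSet.iUnion fun n => (hK n).measurableSet

theorem leafPull_of_mem {A : ℝ} {Γ : Set (Ambient ds du)}
    (hA : ∀ x ∈ Γ, ∀ y ∈ Γ, ‖x - y‖ ≤ A * ‖projS ds du x - projS ds du y‖)
    (f : Ambient ds du → ℂ) {w : Ambient ds du} (hw : w ∈ Γ) :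
    leafPull Γ f (projS ds du w) = f w := by
  have h : ∃ w' ∈ Γ, projS ds du w' = projS ds du w := ⟨w, hw, rfl⟩
  rw [leafPull, dif_pos h]
  have := hA _ h.choose_spec.1 _ hw
  rw [h.choose_spec.2, sub_self, norm_zero, mul_zero] at this
  rw [sub_eq_zero.1 (norm_le_zero_iff.1 this)]

theorem leafPull_of_notMem {Γ : Set (Ambient ds du)} (f : Ambient ds du → ℂ)
    {z : EuclideanSpace ℝ (Fin ds)} (hz : z ∉ projS ds du '' Γ) : leafPull Γ f z = 0 := by
  rw [leafPull, dif_neg]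
  exact hz

theorem leafPull_add (Γ : Set (Ambient ds du)) (f g : Ambient ds du → ℂ) (z) :
    leafPull Γ (f + g) z = leafPull Γ f z + leafPull Γ g z := by
  unfold leafPull; split_ifs <;> simp

theorem leafPull_smul (Γ : Set (Ambient ds du)) (c : ℂ) (f : Ambient ds du → ℂ) (z) :
    leafPull Γ (c • f) z = c * leafPull Γ f z := by
  unfold leafPull; split_ifs <;> simp

theorem leafPull_decay (Γ : Set (Ambient ds du)) (f : Ambient ds du → ℂ) {N : ℕ} {H : ℝ}
    (hH : 0 ≤ H) (hf : ∀ x, ‖f x‖ * (1 + ‖x‖) ^ N ≤ H) (z) :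
    ‖leafPull Γ f z‖ * (1 + ‖z‖) ^ N ≤ H := by
  unfold leafPull
  split_ifs with h
  · refine le_trans ?_ (hf h.choose)
    have h1 : ‖z‖ ≤ ‖h.choose‖ := by
      conv_lhs => rw [← h.choose_spec.2]
      exact norm_projS_le _
    gcongr
  · simpa using hH

theorem measurable_leafPull {A : NNReal} {Γ : Set (Ambient ds du)} (hΓ : IsLocallyClosed Γ)
    (hA : ∀ x ∈ Γ, ∀ y ∈ Γ, ‖x - y‖ ≤ A * ‖projS ds du x - projS ds du y‖)
    {f : Ambient ds du → ℂ} (hf : Continuous f) :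
    AEStronglyMeasurable (leafPull Γ f) volume := by
  have hm := measurableSet_image_projS hΓ
  have e : leafPull Γ f = (projS ds du '' Γ).indicator (leafPull Γ f) := by
    ext z
    by_cases hz : z ∈ projS ds du '' Γ
    · rw [Set.indicator_of_mem hz]
    · rw [Set.indicator_of_notMem hz, leafPull_of_notMem f hz]
  rw [e]
  refine (aestronglyMeasurable_indicator_iff hm).2 (ContinuousOn.aestronglyMeasurable ?_ hm)
  classical
  set g : EuclideanSpace ℝ (Fin ds) → Ambient ds du := fun z =>
    if h : ∃ w ∈ Γ, projS ds du w = z then h.choose else 0 with hg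
  have hgs : ∀ z ∈ projS ds du '' Γ, g z ∈ Γ ∧ projS ds du (g z) = z := by
    intro z hz
    have h : ∃ w ∈ Γ, projS ds du w = z := hz
    simp only [hg, dif_pos h]
    exact h.choose_spec
  have hL : LipschitzOnWith A g (projS ds du '' Γ) := by
    refine LipschitzOnWith.of_dist_le_mul fun z hz z' hz' => ?_
    have := hA _ (hgs z hz).1 _ (hgs z' hz').1
    rw [(hgs z hz).2, (hgs z' hz').2] at this
    simpa [dist_eq_norm] using this
  refine (hf.comp_continuousOn hL.continuousOn).congr fun z hz => ?_
  have h : ∃ w ∈ Γ, projS ds du w = z := hz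
  simp [leafPull, hg, dif_pos h]

theorem integrable_leafPull {A : NNReal} {Γ : Set (Ambient ds du)} (hΓ : IsLocallyClosed Γ)
    (hA : ∀ x ∈ Γ, ∀ y ∈ Γ, ‖x - y‖ ≤ A * ‖projS ds du x - projS ds du y‖)
    (f : 𝓢(Ambient ds du, ℂ)) : Integrable (leafPull Γ f) := by
  obtain ⟨H, hH, hf⟩ := schwartz_decay f (ds + 1)
  have hI : Integrable (fun z : EuclideanSpace ℝ (Fin ds) => (1 + ‖z‖) ^ (-((ds : ℝ) + 1))) :=
    integrable_one_add_norm (by simp)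
  refine (hI.const_mul H).mono' (measurable_leafPull hΓ hA f.continuous)
    (Filter.Eventually.of_forall fun z => ?_)
  have := leafPull_decay Γ f hH hf z
  rw [Real.rpow_neg (by positivity), ← div_eq_mul_inv, le_div_iff₀ (by positivity)]
  exact_mod_cast this

theorem continuous_invFourier {V : Type*} [NormedAddCommGroup V] [InnerProductSpace ℝ V]
    [FiniteDimensional ℝ V] [MeasurableSpace V] [BorelSpace V] (χ : Cutoff) (n : ℕ) :
    Continuous (invFourier (V := V) (lpSymbol χ n)) ∧
      ∃ B, ∀ x : V, ‖invFourier (lpSymbol χ n) x‖ ≤ B := by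
  have e : invFourier (V := V) (lpSymbol χ n) = _ := funext fun x =>
    invFourier_eq_schwartz _ (hasCompactSupport_lpSymbol χ n) (contDiff_lpSymbol χ n) x
  rw [e]
  refine ⟨SchwartzMap.continuous _, ?_⟩
  obtain ⟨H, -, h⟩ := schwartz_decay (FourierTransformInv.fourierInv
    (symbolS (V := V) _ (hasCompactSupport_lpSymbol χ n) (contDiff_lpSymbol χ n)) : 𝓢(V, ℂ)) 0
  exact ⟨H, fun x => by simpa using h x⟩

theorem integrable_kernel_mul (χ : Cutoff) (n : ℕ) {f : EuclideanSpace ℝ (Fin ds) → ℂ}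
    (hf : Integrable f) (y : EuclideanSpace ℝ (Fin ds)) :
    Integrable (fun z => invFourier (lpSymbol χ n) (y - z) * f z) := by
  obtain ⟨hc, B, hB⟩ := continuous_invFourier (V := EuclideanSpace ℝ (Fin ds)) χ n
  exact hf.bdd_mul (c := B) (hc.comp (by fun_prop)).aestronglyMeasurable
    (Filter.Eventually.of_forall fun z => hB _)

theorem continuous_leafOp (χ : Cutoff) (n : ℕ) {Γ : Set (Ambient ds du)}
    {f : Ambient ds du → ℂ} (hf : Integrable (leafPull Γ f)) :
    Continuous (leafOp χ n Γ f) := by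
  obtain ⟨hc, B, hB⟩ := continuous_invFourier (V := EuclideanSpace ℝ (Fin ds)) χ n
  refine continuous_of_dominated (bound := fun z => B * ‖leafPull Γ f z‖)
    (fun w => (integrable_kernel_mul χ n hf _).aestronglyMeasurable)
    (fun w => Filter.Eventually.of_forall fun z => ?_) (hf.norm.const_mul B)
    (Filter.Eventually.of_forall fun z => ?_)
  · rw [norm_mul]
    gcongr
    exact hB _
  · exact (hc.comp (continuous_projS.sub continuous_const)).mul continuous_const

theorem leafOp_add (χ : Cutoff) (n : ℕ) {Γ : Set (Ambient ds du)} {f g : Ambient ds du → ℂ}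
    (hf : Integrable (leafPull Γ f)) (hg : Integrable (leafPull Γ g)) :
    leafOp χ n Γ (f + g) = leafOp χ n Γ f + leafOp χ n Γ g := by
  ext w
  simp only [leafOp, Pi.add_apply, leafPull_add, mul_add]
  exact integral_add (integrable_kernel_mul χ n hf _) (integrable_kernel_mul χ n hg _)

theorem leafOp_smul (χ : Cutoff) (n : ℕ) (Γ : Set (Ambient ds du)) (c : ℂ)
    (f : Ambient ds du → ℂ) : leafOp χ n Γ (c • f) = c • leafOp χ n Γ f := by
  ext w
  simp only [leafOp, Pi.smul_apply, leafPull_smul, smul_eq_mul, ← integral_const_mul]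
  exact integral_congr_ae (Filter.Eventually.of_forall fun z => by ring)

theorem leafMeasure_map_le {A : NNReal} {Γ : Set (Ambient ds du)} (hΓ : IsLocallyClosed Γ)
    (hA : ∀ x ∈ Γ, ∀ y ∈ Γ, ‖x - y‖ ≤ A * ‖projS ds du x - projS ds du y‖) :
    (leafMeasure Γ).map (projS ds du) ≤
      ((A : ℝ≥0∞) ^ (ds : ℝ)) • (volume : Measure (EuclideanSpace ℝ (Fin ds))) := by
  refine Measure.le_iff.2 fun B hB => ?_
  have hpre : MeasurableSet (projS ds du ⁻¹' B) := continuous_projS.measurable hB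
  rw [Measure.map_apply continuous_projS.measurable hB, leafMeasure,
    Measure.restrict_apply hpre, Measure.smul_apply, smul_eq_mul,
    ← EuclideanSpace.euclideanHausdorffMeasure_eq_volume]
  have hanti : AntilipschitzWith A (fun x : Γ => projS ds du (x : Ambient ds du)) := by
    refine AntilipschitzWith.of_le_mul_dist fun x y => ?_
    have := hA x x.2 y y.2
    rw [Subtype.dist_eq, dist_eq_norm, dist_eq_norm]
    exact this
  have h1 := hanti.hausdorffMeasure_preimage_le (d := (ds : ℝ)) (by positivity) B
  have h2 : projS ds du ⁻¹' B ∩ Γ =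
      Subtype.val '' ((fun x : Γ => projS ds du (x : Ambient ds du)) ⁻¹' B) := by
    ext x
    simp [and_comm]
  rw [h2, (isometry_subtype_coe).euclideanHausdorffMeasure_image]
  simp only [Measure.euclideanHausdorffMeasure_def, Measure.smul_apply, ENNReal.smul_def,
    smul_eq_mul]
  calc _ ≤ _ := mul_le_mul_right h1 _
    _ = _ := by ring

/-- The weight used to bound the norms. -/
def weight (N : ℕ) {V : Type*} [Norm V] (z : V) : ℝ := (1 + ‖z‖) ^ (-((N : ℝ)))

theorem memLp_weight (p : ℝ≥0∞) (hp : 1 ≤ p) :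
    MemLp (fun z : EuclideanSpace ℝ (Fin ds) => weight (ds + 1) z) p volume := by
  have hI : Integrable (fun z : EuclideanSpace ℝ (Fin ds) => weight (ds + 1) z) := by
    unfold weight
    exact integrable_one_add_norm (by simp)
  have h1 : ∀ z : EuclideanSpace ℝ (Fin ds), ‖weight (ds + 1) z‖ ≤ 1 := by
    intro z
    rw [weight, Real.norm_of_nonneg (by positivity)]
    exact Real.rpow_le_one_of_one_le_of_nonpos (by simp) (neg_nonpos.2 (Nat.cast_nonneg _))
  have htop : MemLp (fun z : EuclideanSpace ℝ (Fin ds) => weight (ds + 1) z) ⊤ volume :=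
    memLp_top_of_bound hI.aestronglyMeasurable 1 (Filter.Eventually.of_forall h1)
  rcases eq_or_ne p ⊤ with rfl | hpt
  · exact htop
  have hp0 : p ≠ 0 := (zero_lt_one.trans_le hp).ne'
  refine (integrable_norm_rpow_iff hI.aestronglyMeasurable hp0 hpt).1 ?_
  refine hI.norm.mono' (hI.aestronglyMeasurable.norm.aemeasurable.pow_const _).aestronglyMeasurable
    (Filter.Eventually.of_forall fun z => ?_)
  have hp1 : 1 ≤ p.toReal := by
    rw [← ENNReal.toReal_one]; exact ENNReal.toReal_mono hpt hp
  rw [Real.norm_of_nonneg (by positivity)]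
  calc ‖weight (ds + 1) z‖ ^ p.toReal ≤ ‖weight (ds + 1) z‖ ^ (1 : ℝ) :=
        Real.rpow_le_rpow_of_exponent_ge' (norm_nonneg _) (h1 z) zero_le_one hp1
    _ = _ := Real.rpow_one _

theorem eLpNorm_leaf_le {A : NNReal} {Γ : Set (Ambient ds du)} (hΓ : IsLocallyClosed Γ)
    (hA : ∀ x ∈ Γ, ∀ y ∈ Γ, ‖x - y‖ ≤ A * ‖projS ds du x - projS ds du y‖)
    {p : ℝ≥0∞} (hp : 1 ≤ p) {g : Ambient ds du → ℂ} {H : ℝ}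
    (hg : ∀ w, ‖g w‖ * (1 + ‖projS ds du w‖) ^ (ds + 1) ≤ H) :
    eLpNorm g p (leafMeasure Γ) ≤ ENNReal.ofReal H *
      eLpNorm (fun z : EuclideanSpace ℝ (Fin ds) => weight (ds + 1) z) p
        (((A : ℝ≥0∞) ^ (ds : ℝ)) • volume) := by
  have hc : Continuous (fun z : EuclideanSpace ℝ (Fin ds) => weight (ds + 1) z) := by
    unfold weight
    refine Continuous.rpow_const (by fun_prop) fun z => Or.inl ?_
    positivity
  refine (eLpNorm_le_mul_eLpNorm_of_ae_le_mul (c := H)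
    (g := (fun z : EuclideanSpace ℝ (Fin ds) => weight (ds + 1) z) ∘ projS ds du)
    (Filter.Eventually.of_forall fun w => ?_) p).trans ?_
  · rw [Function.comp, weight, Real.norm_of_nonneg (by positivity), Real.rpow_neg (by positivity),
      ← div_eq_mul_inv, le_div_iff₀ (by positivity)]
    exact_mod_cast hg w
  · gcongr
    rw [← eLpNorm_map_measure hc.aestronglyMeasurable continuous_projS.aemeasurable]
    exact eLpNorm_mono_measure _ (leafMeasure_map_le hΓ hA)

variable (χ : Cutoff) (r : ℝ) (C : ConePair ds du) (CF : ℝ) (p : ℝ≥0∞) (t s : ℝ)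

theorem leafNorm_add_le (hC : C.HorizontalSubset) (hp : 1 ≤ p) {Γ : Set (Ambient ds du)}
    (hΓ : IsFakeLeaf r C.plus CF Γ) (f g : 𝓢(Ambient ds du, ℂ)) :
    leafNorm χ p s Γ (f + g : 𝓢(Ambient ds du, ℂ)) ≤ leafNorm χ p s Γ f + leafNorm χ p s Γ g := by
  obtain ⟨A, hA⟩ := C.exists_lipschitz hC
  have hl := hΓ.isLocallyClosed
  have hf := integrable_leafPull hl (hA r CF Γ hΓ) f
  have hg := integrable_leafPull hl (hA r CF Γ hΓ) g
  refine iSup_le fun n => ?_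
  have e : ((f + g : 𝓢(Ambient ds du, ℂ)) : Ambient ds du → ℂ) = ⇑f + ⇑g := rfl
  rw [e, leafOp_add χ n hf hg]
  refine (mul_le_mul_right (eLpNorm_add_le (continuous_leafOp χ n hf).aestronglyMeasurable
    (continuous_leafOp χ n hg).aestronglyMeasurable hp) _).trans ?_
  rw [mul_add]
  exact add_le_add (le_iSup (fun n : ℕ => ENNReal.ofReal ((2 : ℝ) ^ ((n : ℝ) * s)) *
      eLpNorm (leafOp χ n Γ f) p (leafMeasure Γ)) n)
    (le_iSup (fun n : ℕ => ENNReal.ofReal ((2 : ℝ) ^ ((n : ℝ) * s)) *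
      eLpNorm (leafOp χ n Γ g) p (leafMeasure Γ)) n)

theorem uENorm_add_le (hC : C.HorizontalSubset) (hp : 1 ≤ p) (f g : 𝓢(Ambient ds du, ℂ)) :
    uENorm χ r C CF p t s (f + g) ≤ uENorm χ r C CF p t s f + uENorm χ r C CF p t s g := by
  refine iSup_le fun Γ => iSup_le fun hΓ => iSup_le fun l => ?_
  rw [map_add]
  refine (mul_le_mul_right (leafNorm_add_le χ r C CF p s hC hp hΓ _ _) _).trans ?_
  rw [mul_add]
  refine add_le_add ?_ ?_
  · exact le_iSup_of_le Γ (le_iSup_of_le hΓ (le_iSup_of_le l le_rfl))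
  · exact le_iSup_of_le Γ (le_iSup_of_le hΓ (le_iSup_of_le l le_rfl))

theorem uENorm_smul (c : ℂ) (f : 𝓢(Ambient ds du, ℂ)) :
    uENorm χ r C CF p t s (c • f) = ‖c‖ₑ * uENorm χ r C CF p t s f := by
  have h : ∀ (Γ : Set (Ambient ds du)) (g : 𝓢(Ambient ds du, ℂ)),
      leafNorm χ p s Γ (c • g : 𝓢(Ambient ds du, ℂ)) = ‖c‖ₑ * leafNorm χ p s Γ g := by
    intro Γ g
    unfold leafNorm
    rw [ENNReal.mul_iSup]
    refine iSup_congr fun n => ?_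
    have e : ((c • g : 𝓢(Ambient ds du, ℂ)) : Ambient ds du → ℂ) = c • ⇑g := rfl
    rw [e, leafOp_smul, eLpNorm_const_smul]
    ring
  unfold uENorm
  simp only [map_smul, h, ENNReal.mul_iSup]
  refine iSup_congr fun Γ => iSup_congr fun hΓ => iSup_congr fun l => ?_
  ring

theorem uENorm_lt_top (hC : C.HorizontalSubset) (hp : 1 ≤ p) (hs : s ≤ 0)
    (f : 𝓢(Ambient ds du, ℂ)) : uENorm χ r C CF p t s f < ⊤ := by
  obtain ⟨A, hA⟩ := C.exists_lipschitz hC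
  obtain ⟨H, hH, hf⟩ := lpOp_decay χ t (ds + 1) f
  obtain ⟨B, hB, hk⟩ := lpKernel_decay (V := EuclideanSpace ℝ (Fin ds)) χ (ds + 1)
  set Q := eLpNorm (fun z : EuclideanSpace ℝ (Fin ds) => weight (ds + 1) z) p
        (((A : ℝ≥0∞) ^ (ds : ℝ)) • volume) with hQ
  have hQt : Q < ⊤ := ((memLp_weight p hp).smul_measure
    (ENNReal.rpow_ne_top_of_nonneg (by positivity) ENNReal.coe_ne_top)).2
  refine lt_of_le_of_lt ?_ (ENNReal.mul_lt_top (ENNReal.ofReal_lt_top (r := B * H)) hQt)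
  refine iSup_le fun Γ => iSup_le fun hΓ => iSup_le fun l => ?_
  rw [leafNorm, ENNReal.mul_iSup]
  refine iSup_le fun n => ?_
  have ht : (0 : ℝ) < (2 : ℝ) ^ ((l : ℝ) * t) := by positivity
  set H' := H / (2 : ℝ) ^ ((l : ℝ) * t) with hH'
  have hH'0 : 0 ≤ H' := by positivity
  have h1 : ∀ x, ‖lpOp χ l f x‖ * (1 + ‖x‖) ^ (ds + 1) ≤ H' := by
    intro x
    rw [hH', le_div_iff₀ ht]
    linarith [hf l x]
  have h2 := eLpNorm_leaf_le hΓ.isLocallyClosed (hA r CF Γ hΓ) hp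
    (g := leafOp χ n Γ (lpOp χ l f)) (H := B * H')
    (fun w => hk n _ H' hH'0 (leafPull_decay Γ _ hH'0 h1) _)
  have h3 : ENNReal.ofReal ((2 : ℝ) ^ ((n : ℝ) * s)) ≤ 1 := by
    rw [ENNReal.ofReal_le_one]
    exact Real.rpow_le_one_of_one_le_of_nonpos one_le_two
      (mul_nonpos_of_nonneg_of_nonpos (by positivity) hs)
  calc _ ≤ ENNReal.ofReal ((2 : ℝ) ^ ((l : ℝ) * t)) * (1 * (ENNReal.ofReal (B * H') * Q)) := by
        gcongr
    _ = ENNReal.ofReal ((2 : ℝ) ^ ((l : ℝ) * t) * (B * H')) * Q := by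
        rw [one_mul, ← mul_assoc, ← ENNReal.ofReal_mul ht.le]
    _ = _ := by
        congr 2
        rw [hH']
        field_simp

end Leaves

/-! ### The local space -/

/-- `C^∞(K)`: smooth functions `ℝ^d → ℂ` supported in `K`. For compact `K` they are rapidly
decreasing, and they are realized inside the Schwartz space. -/
def smoothIn {ds du : ℕ} (K : Set (Ambient ds du)) : Submodule ℂ 𝓢(Ambient ds du, ℂ) where
  carrier := {f | ∀ x ∉ K, f x = 0}
  add_mem' hf hg x hx := by simp [hf x hx, hg x hx]
  zero_mem' _ _ := rfl
  smul_mem' c f hf x hx := by simp [hf x hx]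

/-- `C^∞(K)` endowed with the norm `‖·‖_{𝓤^{C_±,t,s}_p}`. -/
def PreU {ds du : ℕ} (_χ : Cutoff) (_r : ℝ) {C : ConePair ds du} (_hC : C.HorizontalSubset)
    (_CF : ℝ) (p : ℝ≥0∞) [Fact (1 ≤ p)] (_t : ℝ) {s : ℝ} (_hs : s ≤ 0)
    (K : Set (Ambient ds du)) : Type :=
  smoothIn K

section Space

variable {ds du : ℕ} (χ : Cutoff) (r : ℝ) {C : ConePair ds du} (hC : C.HorizontalSubset)
  (CF : ℝ) (p : ℝ≥0∞) [hp : Fact (1 ≤ p)] (t : ℝ) {s : ℝ} (hs : s ≤ 0)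
  (K : Set (Ambient ds du))

instance : AddCommGroup (PreU χ r hC CF p t hs K) := inferInstanceAs (AddCommGroup (smoothIn K))

instance : Module ℂ (PreU χ r hC CF p t hs K) := inferInstanceAs (Module ℂ (smoothIn K))

/-- The norm `‖φ‖_{𝓤^{C_±,t,s}_p}`, as a real number. -/
def uSeminorm : AddGroupSeminorm (PreU χ r hC CF p t hs K) where
  toFun φ := (uENorm χ r C CF p t s (show smoothIn K from φ : 𝓢(Ambient ds du, ℂ))).toReal
  map_zero' := by
    have := uENorm_smul χ r C CF p t s 0 (0 : 𝓢(Ambient ds du, ℂ))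
    rw [zero_smul, enorm_zero, zero_mul] at this
    change (uENorm χ r C CF p t s (0 : 𝓢(Ambient ds du, ℂ))).toReal = 0
    rw [this, ENNReal.toReal_zero]
  add_le' f g := by
    have hf := uENorm_lt_top χ r C CF p t s hC hp.out hs (show smoothIn K from f).1
    have hg := uENorm_lt_top χ r C CF p t s hC hp.out hs (show smoothIn K from g).1
    rw [← ENNReal.toReal_add hf.ne hg.ne]
    exact ENNReal.toReal_mono (ENNReal.add_lt_top.2 ⟨hf, hg⟩).ne
      (uENorm_add_le χ r C CF p t s hC hp.out _ _)
  neg' f := by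
    have := uENorm_smul χ r C CF p t s (-1) (show smoothIn K from f).1
    rw [neg_one_smul, enorm_neg, enorm_one, one_mul] at this
    exact congrArg ENNReal.toReal this

instance : SeminormedAddCommGroup (PreU χ r hC CF p t hs K) :=
  (uSeminorm χ r hC CF p t hs K).toSeminormedAddCommGroup

instance : NormedSpace ℂ (PreU χ r hC CF p t hs K) where
  norm_smul_le c f := by
    have := uENorm_smul χ r C CF p t s c (show smoothIn K from f).1
    refine le_of_eq ((congrArg ENNReal.toReal this).trans ?_)
    rw [ENNReal.toReal_mul, toReal_enorm]
    rfl

/-- The space `𝓤^{C_±,t,s}_p(K)`: the completion of `C^∞(K)` for `‖·‖_{𝓤^{C_±,t,s}_p}`. -/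
abbrev USpace : Type := UniformSpace.Completion (PreU χ r hC CF p t hs K)

/-- The canonical map `C^∞(K) → 𝓤^{C_±,t,s}_p(K)`. -/
def toU : smoothIn K →ₗ[ℂ] USpace χ r hC CF p t hs K :=
  (UniformSpace.Completion.toComplₗᵢ (𝕜 := ℂ) (E := PreU χ r hC CF p t hs K)).toLinearMap

theorem norm_toU (φ : smoothIn K) :
    ‖toU χ r hC CF p t hs K φ‖ = (uENorm χ r C CF p t s (φ : 𝓢(Ambient ds du, ℂ))).toReal :=
  UniformSpace.Completion.norm_coe (E := PreU χ r hC CF p t hs K) φ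

theorem denseRange_toU : DenseRange (toU χ r hC CF p t hs K) :=
  UniformSpace.Completion.denseRange_coe (α := PreU χ r hC CF p t hs K)

end Space

/-- The operator `𝓡_n u = φ · ∑_{m ≤ n} ψ_m^{Op} u` on `C^∞(K)`, for `φ ∈ C^∞(K)`. -/
def truncOp {ds du : ℕ} (χ : Cutoff) {K : Set (Ambient ds du)} (φ : smoothIn K) (n : ℕ) :
    smoothIn K →ₗ[ℂ] smoothIn K where
  toFun u := ⟨SchwartzMap.smulLeftCLM ℂ (φ : 𝓢(Ambient ds du, ℂ))
    (∑ m ∈ Finset.range (n + 1), lpOp χ m (u : 𝓢(Ambient ds du, ℂ))), fun x hx => by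
      rw [SchwartzMap.smulLeftCLM_apply_apply (φ : 𝓢(Ambient ds du, ℂ)).hasTemperateGrowth,
        φ.2 x hx, zero_smul]⟩
  map_add' u v := Subtype.ext (by simp [Finset.sum_add_distrib])
  map_smul' c u := Subtype.ext (by simp [← Finset.smul_sum])

theorem truncOp_apply {ds du : ℕ} (χ : Cutoff) {K : Set (Ambient ds du)} (φ : smoothIn K) (n : ℕ)
    (u : smoothIn K) (x : Ambient ds du) :
    (truncOp χ φ n u : 𝓢(Ambient ds du, ℂ)) x = (φ : 𝓢(Ambient ds du, ℂ)) x *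
      ∑ m ∈ Finset.range (n + 1), lpOp χ m (u : 𝓢(Ambient ds du, ℂ)) x := by
  change SchwartzMap.smulLeftCLM ℂ (φ : 𝓢(Ambient ds du, ℂ))
    (∑ m ∈ Finset.range (n + 1), lpOp χ m (u : 𝓢(Ambient ds du, ℂ))) x = _
  rw [SchwartzMap.smulLeftCLM_apply_apply (φ : 𝓢(Ambient ds du, ℂ)).hasTemperateGrowth,
    sum_apply, smul_eq_mul]

end AnisoU

end

/-! The function `φ · ∑_{l ≤ n₀} ψ_l^{Op} u` is a fixed cut-off times a band-limited function, and a
band-limited function is determined by its samples on a fine enough lattice. In the frequency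
variable `ζ = ξ / 2π` the spectrum of the sum lies in the ball of radius `2^{n₀} / π`. After
rescaling by `2^{n₁}` with `n₁ ≥ n₀` it lies in the ball of radius `1/π < 1/2`, strictly inside the
unit cube. Parseval on the torus then expands the sum over the samples at `2^{-n₁} k`, with building
blocks `κ(2^{n₁} x - k)`; because of the room between `1/π` and `1/2`, `κ` can be taken Schwartz
(`hasSum_sampling`, `exists_sampling_kernel`).

The finite rank operator keeps the `k` in `2^{n₁}` times a box around `K` with margin `1`; counting
these gives the rank (`exists_finset_lattice`). For the discarded `k` and `x ∈ K` the distance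
`|2^{n₁} x - k|` is at least about `2^{n₁}`, so the decay of `κ` gives a factor `2^{-m n₁}` for any
`m`. All other losses are at most `2^{b n₁}` with `b` independent of `m`, so a large `m` yields the
rate `2^{-d v n₁}`.

There are two kinds of loss. In the target, the norm of any cone pair is dominated by a Schwartz
norm (`uENorm_le_schwartzNorm`), and the tail of the series is estimated in that norm
(`exists_schwartzNorm_tsum_atomFun_le`). In the source, the samples must be bounded by the
anisotropic norm (`exists_norm_lpOp_le`). Through each point passes an affine leaf, parallel to the
orthogonal complement of a `d_u`-dimensional subspace of `C_+`. Restricted to it, `ψ_l^{Op} u` is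
still band-limited, so it is reproduced by a smooth kernel on `ℝ^{d_s}`. Splitting it into leafwise
Littlewood-Paley pieces and applying Hölder's inequality costs a power of `2^l`. Since source and
target meet only through these two bounds, the two cone pairs need not be related. -/

noncomputable section

namespace AnisoU

/-! ### The sampling theorem for band-limited functions on `ℝ^d` -/

section Sampling

-- Haar measure of mass one is made the volume of the circle: the characters `mFourier` are
-- orthonormal for the resulting product measure on the torus.
local instance haarMeasureSpaceUnitAddCircle : MeasureSpace UnitAddCircle :=
  ⟨AddCircle.haarAddCircle⟩

local instance haarUnitAddCircle_isProbabilityMeasure :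
    IsProbabilityMeasure (volume : Measure UnitAddCircle) :=
  inferInstanceAs (IsProbabilityMeasure AddCircle.haarAddCircle)

variable {ι : Type*} [Fintype ι]

/-- The unit cube centred at the origin. -/
def unitCube (ι : Type*) : Set (ι → ℝ) := {x | ∀ i, x i ∈ Set.Ioc (-(1 / 2) : ℝ) (-(1 / 2) + 1)}

/-- The function on the torus which agrees with `a` on the unit cube. -/
def torusLift (a : (ι → ℝ) → ℂ) (θ : UnitAddTorus ι) : ℂ :=
  a (UnitAddTorus.measurableEquivPiIoc (fun _ : ι => (-(1 / 2) : ℝ)) θ).1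

theorem torusLift_apply (a : (ι → ℝ) → ℂ) {x : ι → ℝ} (hx : x ∈ unitCube ι) :
    torusLift a (fun i => (x i : UnitAddCircle)) = a x := by
  have := (UnitAddTorus.measurableEquivPiIoc (fun _ : ι => (-(1 / 2) : ℝ))).apply_symm_apply ⟨x, hx⟩
  rw [UnitAddTorus.coe_symm_measurableEquivPiIoc_apply] at this
  rw [torusLift, this]

theorem measurable_torusLift {a : (ι → ℝ) → ℂ} (ha : Measurable a) :
    Measurable (torusLift a) :=
  ha.comp (measurable_subtype_coe.comp (MeasurableEquiv.measurable _))

theorem measurableSet_unitCube : MeasurableSet (unitCube ι) :=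
  MeasurableSet.univ_pi' fun _ => measurableSet_Ioc

theorem memLp_torusLift {a : (ι → ℝ) → ℂ} (ha : Measurable a) {B : ℝ} (hB : ∀ x, ‖a x‖ ≤ B) :
    MemLp (torusLift a) 2 (volume : Measure (UnitAddTorus ι)) :=
  MemLp.of_bound (measurable_torusLift ha).aestronglyMeasurable B
    (Filter.Eventually.of_forall fun _ => hB _)

/-- Coefficients on the torus become Fourier integrals over the cube. For functions supported in the
cube these are values of the inverse Fourier transform at the points `-k`. -/
theorem mFourierCoeff_torusLift {a : (ι → ℝ) → ℂ} (ha : Measurable a) {B : ℝ}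
    (hB : ∀ x, ‖a x‖ ≤ B) (k : ι → ℤ) :
    UnitAddTorus.mFourierCoeff ((memLp_torusLift ha hB).toLp _) k =
      ∫ x in unitCube ι, Complex.exp ((↑(-(2 * Real.pi * ∑ i, (k i : ℝ) * x i)) : ℂ) * Complex.I) *
        a x := by
  have h1 : UnitAddTorus.mFourierCoeff ((memLp_torusLift ha hB).toLp _) k =
      UnitAddTorus.mFourierCoeff (torusLift a) k := by
    refine integral_congr_ae ?_
    filter_upwards [(memLp_torusLift ha hB).coeFn_toLp] with θ hθ
    rw [hθ]
  rw [h1, UnitAddTorus.mFourierCoeff_eq_integral _ _ (fun _ => (-(1 / 2) : ℝ))]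
  refine setIntegral_congr_fun measurableSet_unitCube fun x hx => ?_
  simp only [smul_eq_mul]
  rw [torusLift_apply a hx]
  congr 1
  simp only [UnitAddTorus.mFourier, ContinuousMap.coe_mk, fourier_coe_apply, Pi.neg_apply]
  rw [← Complex.exp_sum]
  congr 1
  push_cast
  rw [← mul_neg, ← Finset.sum_neg_distrib, Finset.mul_sum, Finset.sum_mul]
  refine Finset.sum_congr rfl fun i _ => ?_
  ring

/-- Parseval's identity in `L²` of the torus, transported to the cube. -/
theorem hasSum_integral_unitCube {a c : (ι → ℝ) → ℂ} (ha : Measurable a) (hc : Measurable c)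
    {A B : ℝ} (hA : ∀ x, ‖a x‖ ≤ A) (hB : ∀ x, ‖c x‖ ≤ B) :
    HasSum (fun k : ι → ℤ =>
      starRingEnd ℂ (∫ x in unitCube ι,
        Complex.exp ((↑(-(2 * Real.pi * ∑ i, (k i : ℝ) * x i)) : ℂ) * Complex.I) * a x) *
      ∫ x in unitCube ι,
        Complex.exp ((↑(-(2 * Real.pi * ∑ i, (k i : ℝ) * x i)) : ℂ) * Complex.I) * c x)
      (∫ x in unitCube ι, starRingEnd ℂ (a x) * c x) := by
  have h := UnitAddTorus.hasSum_prod_mFourierCoeff ((memLp_torusLift ha hA).toLp _)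
    ((memLp_torusLift hc hB).toLp _)
  simp only [mFourierCoeff_torusLift ha hA, mFourierCoeff_torusLift hc hB] at h
  convert h using 1
  have h1 : ∫ t, starRingEnd ℂ ((memLp_torusLift ha hA).toLp _ t) *
      ((memLp_torusLift hc hB).toLp _ t) =
      ∫ t : UnitAddTorus ι, starRingEnd ℂ (torusLift a t) * torusLift c t := by
    refine integral_congr_ae ?_
    filter_upwards [(memLp_torusLift ha hA).coeFn_toLp, (memLp_torusLift hc hB).coeFn_toLp]
      with θ hθ hθ'
    rw [hθ, hθ']
  rw [h1, UnitAddTorus.integral_preimage _ (fun _ => (-(1 / 2) : ℝ))]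
  refine setIntegral_congr_fun measurableSet_unitCube fun x hx => ?_
  simp only [torusLift_apply _ hx]

/-- Lattice points of `ℤ^ι` as vectors. -/
def latticePt (k : ι → ℤ) : EuclideanSpace ℝ ι := WithLp.toLp 2 fun i => (k i : ℝ)

theorem latticePt_neg (k : ι → ℤ) : latticePt (-k) = -latticePt k := by
  ext i; simp [latticePt]

theorem inner_latticePt (k : ι → ℤ) (x : ι → ℝ) :
    inner ℝ (WithLp.toLp 2 x) (latticePt k) = ∑ i, (k i : ℝ) * x i := by
  simp [latticePt, PiLp.inner_apply]

/-- Each coordinate is bounded by the Euclidean norm, so the open ball of radius `1/2` lies in the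
cube and the half-open faces play no role. -/
theorem integral_unitCube_toLp {F : EuclideanSpace ℝ ι → ℂ} (hF : ∀ w, 1 / 2 ≤ ‖w‖ → F w = 0) :
    ∫ x in unitCube ι, F (WithLp.toLp 2 x) = ∫ w, F w := by
  rw [setIntegral_eq_integral_of_forall_compl_eq_zero,
    (PiLp.volume_preserving_toLp ι).integral_comp (MeasurableEquiv.toLp 2 _).measurableEmbedding]
  intro x hx
  apply hF
  simp only [unitCube, Set.mem_ofPred_eq, not_forall] at hx
  obtain ⟨i, hi⟩ := hx
  have h1 : |x i| ≤ ‖(WithLp.toLp 2 x : EuclideanSpace ℝ ι)‖ := PiLp.norm_apply_le (WithLp.toLp 2 x) i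
  refine le_trans ?_ h1
  by_contra h2
  rw [not_le, abs_lt] at h2
  exact hi ⟨h2.1, by linarith⟩

open FourierTransform in
/-- Sampling: the function with spectrum `F` is determined by its values at lattice points. -/
theorem hasSum_sampling {F η : EuclideanSpace ℝ ι → ℂ} (hF : Continuous F) (hη : Continuous η)
    {ρ : ℝ} (hF0 : ∀ w, ρ ≤ ‖w‖ → F w = 0) (hρ : ρ ≤ 1 / 2) (hη1 : ∀ w, ‖w‖ ≤ ρ → η w = 1)
    (hη0 : ∀ w, 1 / 2 ≤ ‖w‖ → η w = 0) (y : EuclideanSpace ℝ ι) :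
    HasSum (fun k : ι → ℤ => 𝓕⁻ F (latticePt k) * 𝓕⁻ η (y - latticePt k)) (𝓕⁻ F y) := by
  have hbd : ∀ G : EuclideanSpace ℝ ι → ℂ, Continuous G → (∀ w, 1 / 2 ≤ ‖w‖ → G w = 0) →
      ∃ B, ∀ w, ‖G w‖ ≤ B := by
    intro G hG hG0
    have hs : HasCompactSupport G := HasCompactSupport.intro (isCompact_closedBall 0 (1 / 2))
      fun w hw => hG0 w (by
        rw [Metric.mem_closedBall, dist_zero_right, not_le] at hw
        exact hw.le)
    exact hG.bounded_above_of_compact_support hs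
  have hF0' : ∀ w, 1 / 2 ≤ ‖w‖ → F w = 0 := fun w hw => hF0 w (hρ.trans hw)
  obtain ⟨A, hA⟩ := hbd F hF hF0'
  obtain ⟨B, hB⟩ := hbd η hη hη0
  have hexp : ∀ r : ℝ, ‖Complex.exp ((r : ℂ) * Complex.I)‖ = 1 := Complex.norm_exp_ofReal_mul_I
  -- Parseval is applied to `F` and `a`. As `η = 1` where `F ≠ 0`, inserting `η` leaves the pairing
  -- equal to `𝓕⁻ F y`, while the coefficients of `a` become translates of `𝓕⁻ η`, rapidly
  -- decreasing for smooth `η`, instead of sinc functions.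
  set a : EuclideanSpace ℝ ι → ℂ := fun w => starRingEnd ℂ
    (Complex.exp (((2 * Real.pi * inner ℝ w y : ℝ) : ℂ) * Complex.I) * η w) with ha
  have hac : Continuous a := by
    simp only [ha]
    fun_prop
  have hL : Continuous (WithLp.toLp 2 : (ι → ℝ) → EuclideanSpace ℝ ι) :=
    PiLp.continuous_toLp 2 _
  have h := hasSum_integral_unitCube (a := fun x => a (WithLp.toLp 2 x))
    (c := fun x => F (WithLp.toLp 2 x)) (hac.comp hL).measurable (hF.comp hL).measurable
    (A := B) (B := A) (fun x => by
      simp only [ha, RCLike.norm_conj, norm_mul, hexp, one_mul]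
      exact hB _) (fun x => hA _)
  have hval : ∫ x in unitCube ι, starRingEnd ℂ (a (WithLp.toLp 2 x)) * F (WithLp.toLp 2 x) =
      𝓕⁻ F y := by
    rw [integral_unitCube_toLp (F := fun w => starRingEnd ℂ (a w) * F w)
      (fun w hw => by simp [hF0' w hw]), Real.fourierInv_eq']
    refine integral_congr_ae (Filter.Eventually.of_forall fun w => ?_)
    simp only [ha, Complex.conj_conj, smul_eq_mul]
    by_cases hw : ‖w‖ ≤ ρ
    · rw [hη1 w hw, mul_one]
    · rw [hF0 w (not_le.1 hw).le, mul_zero, mul_zero]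
  have hcF : ∀ k : ι → ℤ, ∫ x in unitCube ι,
      Complex.exp ((↑(-(2 * Real.pi * ∑ i, (k i : ℝ) * x i)) : ℂ) * Complex.I) *
        F (WithLp.toLp 2 x) = 𝓕⁻ F (latticePt (-k)) := by
    intro k
    simp only [← inner_latticePt]
    rw [integral_unitCube_toLp (F := fun w => Complex.exp ((↑(-(2 * Real.pi *
      inner ℝ w (latticePt k))) : ℂ) * Complex.I) * F w)
      (fun w hw => by simp [hF0' w hw]), Real.fourierInv_eq']
    simp only [latticePt_neg, inner_neg_right, mul_neg, smul_eq_mul]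
  have hca : ∀ k : ι → ℤ, starRingEnd ℂ (∫ x in unitCube ι,
      Complex.exp ((↑(-(2 * Real.pi * ∑ i, (k i : ℝ) * x i)) : ℂ) * Complex.I) *
        a (WithLp.toLp 2 x)) = 𝓕⁻ η (y - latticePt (-k)) := by
    intro k
    simp only [← inner_latticePt]
    rw [integral_unitCube_toLp (F := fun w => Complex.exp ((↑(-(2 * Real.pi *
      inner ℝ w (latticePt k))) : ℂ) * Complex.I) * a w)
      (fun w hw => by simp [ha, hη0 w hw]), ← integral_conj, Real.fourierInv_eq']
    refine integral_congr_ae (Filter.Eventually.of_forall fun w => ?_)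
    simp only [ha, map_mul, Complex.conj_conj, smul_eq_mul, ← Complex.exp_conj, Complex.conj_I,
      Complex.conj_ofReal, map_neg, neg_neg]
    rw [← mul_assoc, ← Complex.exp_add]
    congr 2
    simp only [latticePt_neg, sub_neg_eq_add, inner_add_right]
    push_cast
    ring
  rw [hval] at h
  simp only [hcF, hca] at h
  -- The coefficient of index `k` samples at `-k`.
  rw [← (Equiv.neg (ι → ℤ)).hasSum_iff]
  refine h.congr_fun fun k => ?_
  simp only [Function.comp, Equiv.neg_apply]
  ring

end Sampling

/-! ### Bounding the norms by Schwartz seminorms -/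

section SchwartzBounds

/-- A Schwartz norm dominating all seminorms of order at most `N`. -/
def schwartzNorm {V : Type*} [NormedAddCommGroup V] [NormedSpace ℝ V] (N : ℕ) :
    Seminorm ℂ 𝓢(V, ℂ) :=
  (Finset.Iic (N, N)).sup fun m => SchwartzMap.seminorm ℂ m.1 m.2

theorem schwartzNorm_le {V : Type*} [NormedAddCommGroup V] [NormedSpace ℝ V] (N : ℕ)
    (f : 𝓢(V, ℂ)) {M : ℝ} (hM : 0 ≤ M)
    (h : ∀ i ≤ N, ∀ j ≤ N, ∀ x, ‖x‖ ^ i * ‖iteratedFDeriv ℝ j f x‖ ≤ M) :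
    schwartzNorm N f ≤ M := by
  refine Seminorm.finset_sup_apply_le hM fun m hm => ?_
  rw [Finset.mem_Iic] at hm
  exact SchwartzMap.seminorm_le_bound ℂ m.1 m.2 f hM (h m.1 hm.1 m.2 hm.2)

/-- A continuous seminorm is controlled by finitely many Schwartz seminorms; `N` is the largest
index among them. -/
theorem exists_le_schwartzNorm {V : Type*} [NormedAddCommGroup V] [NormedSpace ℝ V]
    (q : Seminorm ℂ 𝓢(V, ℂ)) (hq : Continuous q) :
    ∃ (N : ℕ) (C : ℝ), 0 ≤ C ∧ ∀ f, q f ≤ C * schwartzNorm N f := by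
  obtain ⟨s, C, -, h⟩ := Seminorm.bound_of_continuous (schwartz_withSeminorms ℂ V ℂ) q hq
  refine ⟨s.sup (fun m => max m.1 m.2), C, C.2, fun f => (h f).trans ?_⟩
  change (C : ℝ) * _ ≤ _
  refine mul_le_mul_of_nonneg_left ?_ C.2
  refine Seminorm.finset_sup_apply_le (apply_nonneg _ _) fun m hm => ?_
  have h1 : max m.1 m.2 ≤ s.sup (fun m => max m.1 m.2) :=
    Finset.le_sup (f := fun m : ℕ × ℕ => max m.1 m.2) hm
  exact Seminorm.le_finset_sup_apply (x := f)
    (p := fun m : ℕ × ℕ => SchwartzMap.seminorm (F := ℂ) (E := V) ℂ m.1 m.2) (i := m)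
    (Finset.mem_Iic.2 ⟨(le_max_left _ _).trans h1, (le_max_right _ _).trans h1⟩)

variable {V : Type*} [NormedAddCommGroup V] [InnerProductSpace ℝ V]
  [FiniteDimensional ℝ V] [MeasurableSpace V] [BorelSpace V]

/-- Continuity of `A` on the Schwartz space makes the decay constant of `A f` linear in a norm of
`f`. It is used for the identity and for a power of the Laplacian. -/
theorem schwartz_decay_uniform (N : ℕ) (A : 𝓢(V, ℂ) →L[ℂ] 𝓢(V, ℂ)) :
    ∃ (M : ℕ) (C : ℝ), 0 ≤ C ∧ ∀ (f : 𝓢(V, ℂ)) (y : V),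
      ‖A f y‖ * (1 + ‖y‖) ^ N ≤ C * schwartzNorm M f := by
  obtain ⟨M, C, hC, h⟩ := exists_le_schwartzNorm ((schwartzNorm (V := V) N).comp A.toLinearMap)
    ((Seminorm.continuous_finsetSup fun m _ =>
      (schwartz_withSeminorms ℂ V ℂ).continuous_seminorm m).comp A.continuous)
  refine ⟨M, 2 ^ N * C, by positivity, fun f y => ?_⟩
  have h1 := SchwartzMap.one_add_le_sup_seminorm_apply (𝕜 := ℂ) (m := (N, N)) (n := 0) le_rfl
    (Nat.zero_le _) (A f) y
  simp only [norm_iteratedFDeriv_zero] at h1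
  have h2 := h f
  rw [mul_comm]
  refine h1.trans ?_
  rw [mul_assoc]
  exact mul_le_mul_of_nonneg_left h2 (by positivity)

/-- The pieces `ψ_n^{Op} φ` of a Schwartz function decay faster than any `2^{-tn}`, with a bound
by a Schwartz norm of `φ`. -/
theorem lpOp_decay_uniform (χ : Cutoff) (t : ℝ) (N : ℕ) :
    ∃ (L : ℕ) (C : ℝ), 0 ≤ C ∧ ∀ (f : 𝓢(V, ℂ)) (n : ℕ) (x : V),
      (2 : ℝ) ^ ((n : ℝ) * t) * ‖lpOp χ n f x‖ * (1 + ‖x‖) ^ N ≤ C * schwartzNorm L f := by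
  -- For `n ≥ 1` the symbol `ψ_n` is `4^{-nM}` times a dilated ring symbol times `|ξ|^{2M}`. With `M
  -- ≥ t` the first factor absorbs `2^{nt}`; the last one is moved onto `f` as the multiplier `q`.
  obtain ⟨M, hM⟩ := exists_nat_ge t
  set q : V → ℂ := fun ζ => (((‖(2 * Real.pi) • ζ‖ ^ 2) ^ M : ℝ) : ℂ) with hq
  have hqg : q.HasTemperateGrowth := by
    have : q = fun ζ => (((2 * Real.pi) ^ 2) ^ M : ℂ) * (((‖ζ‖ ^ 2 : ℝ) : ℂ) ^ M) := by
      ext ζ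
      simp only [hq, norm_smul, Real.norm_of_nonneg (show (0 : ℝ) ≤ 2 * Real.pi by positivity)]
      push_cast
      ring
    rw [this]
    fun_prop
  set Q : 𝓢(V, ℂ) →L[ℂ] 𝓢(V, ℂ) := SchwartzMap.fourierMultiplierCLM ℂ q
  obtain ⟨L0, C0, hC0, h0'⟩ := schwartz_decay_uniform (V := V) N (ContinuousLinearMap.id ℂ _)
  obtain ⟨L1, C1, hC1, h1'⟩ := schwartz_decay_uniform N Q
  have hK := kerMass_nonneg (V := V) (lpSymbol χ 0) N
  have hK' := kerMass_nonneg (V := V) (ringSymbol χ M) N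
  have hmono : ∀ (L L' : ℕ), L ≤ L' → ∀ f : 𝓢(V, ℂ), schwartzNorm L f ≤ schwartzNorm L' f := by
    intro L L' hL f
    exact Finset.sup_mono (f := fun m : ℕ × ℕ => SchwartzMap.seminorm ℂ (F := ℂ) (E := V) m.1 m.2)
      (Finset.Iic_subset_Iic.2 (show (L, L) ≤ (L', L') from ⟨hL, hL⟩)) f
  refine ⟨max L0 L1, kerMass (V := V) (lpSymbol χ 0) N * C0 + kerMass (V := V) (ringSymbol χ M) N * C1,
    by positivity, fun f n x => ?_⟩
  set S := schwartzNorm (max L0 L1) f with hS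
  have hS0 : 0 ≤ S := apply_nonneg _ _
  have h0 : ∀ y, ‖f y‖ * (1 + ‖y‖) ^ N ≤ C0 * S := fun y => (h0' f y).trans
    (mul_le_mul_of_nonneg_left (hmono _ _ (le_max_left _ _) f) hC0)
  have h1 : ∀ y, ‖Q f y‖ * (1 + ‖y‖) ^ N ≤ C1 * S := fun y => (h1' f y).trans
    (mul_le_mul_of_nonneg_left (hmono _ _ (le_max_right _ _) f) hC1)
  have hH0 : 0 ≤ C0 * S := by positivity
  have hH1 : 0 ≤ C1 * S := by positivity
  rcases Nat.eq_zero_or_pos n with rfl | hn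
  · have := kernel_decay (V := V) (lpSymbol χ 0) (hasCompactSupport_lpSymbol χ 0)
      (contDiff_lpSymbol χ 0) N le_rfl hH0 h0 x
    simp only [inv_one, one_smul] at this
    rw [lpOp_apply]
    simp only [Nat.cast_zero, zero_mul, Real.rpow_zero, one_mul]
    nlinarith [mul_nonneg hK' hH1]
  · have hd := kernel_decay (V := V) (ringSymbol χ M) (hasCompactSupport_ringSymbol χ M)
      (contDiff_ringSymbol χ M) N (c := 2 ^ n) (one_le_pow₀ one_le_two) hH1 h1 x
    set b : V → ℝ := fun ξ => ringSymbol χ M (((2 : ℝ) ^ n)⁻¹ • ξ) with hb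
    have hb1 : HasCompactSupport b := (hasCompactSupport_ringSymbol χ M).comp_homeomorph
      (Homeomorph.smulOfNeZero (((2 : ℝ) ^ n)⁻¹) (by positivity))
    have hb2 : ContDiff ℝ ∞ b := (contDiff_ringSymbol χ M).comp (by fun_prop)
    rw [← multiplier_apply b hb1 hb2] at hd
    have hbg : Function.HasTemperateGrowth (fun ζ : V => ((b ((2 * Real.pi) • ζ) : ℝ) : ℂ)) :=
      (symbolS b hb1 hb2).hasTemperateGrowth
    rw [SchwartzMap.fourierMultiplierCLM_fourierMultiplierCLM_apply hbg hqg] at hd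
    have e : (fun ζ : V => ((lpSymbol χ n ((2 * Real.pi) • ζ) : ℝ) : ℂ)) =
        (((((4 : ℝ) ^ n)⁻¹ ^ M : ℝ) : ℂ)) •
          ((fun ζ : V => ((b ((2 * Real.pi) • ζ) : ℝ) : ℂ)) * q) := by
      ext ζ
      rw [lpSymbol_eq χ hn.ne' M]
      simp [hq, hb]
    have e2 : lpOp χ n f x = (((((4 : ℝ) ^ n)⁻¹ ^ M : ℝ) : ℂ)) *
        SchwartzMap.fourierMultiplierCLM ℂ
          ((fun ζ : V => ((b ((2 * Real.pi) • ζ) : ℝ) : ℂ)) * q) f x := by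
      rw [lpOp, e, SchwartzMap.fourierMultiplierCLM_smul (hbg.mul hqg)]
      rfl
    rw [e2, norm_mul, Complex.norm_real, Real.norm_of_nonneg (by positivity)]
    have e3 : (2 : ℝ) ^ ((n : ℝ) * t) * ((4 : ℝ) ^ n)⁻¹ ^ M ≤ 1 := by
      have a1 : (2 : ℝ) ^ ((n : ℝ) * t) ≤ (2 : ℝ) ^ ((n * M : ℕ) : ℝ) := by
        apply Real.rpow_le_rpow_of_exponent_le one_le_two
        push_cast
        gcongr
      rw [Real.rpow_natCast, pow_mul] at a1
      have a2 : ((2 : ℝ) ^ n) ^ M ≤ ((4 : ℝ) ^ n) ^ M := by gcongr; norm_num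
      rw [inv_pow, ← div_eq_mul_inv, div_le_one (by positivity)]
      exact a1.trans a2
    set Z := ‖SchwartzMap.fourierMultiplierCLM ℂ
          ((fun ζ : V => ((b ((2 * Real.pi) • ζ) : ℝ) : ℂ)) * q) f x‖
    calc _ = ((2 : ℝ) ^ ((n : ℝ) * t) * ((4 : ℝ) ^ n)⁻¹ ^ M) * (Z * (1 + ‖x‖) ^ N) := by ring
      _ ≤ 1 * (Z * (1 + ‖x‖) ^ N) := by gcongr
      _ ≤ _ := by rw [one_mul]; nlinarith [mul_nonneg hK hH0]

end SchwartzBounds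

/-- The anisotropic norm is bounded by a Schwartz norm. -/
theorem uENorm_le_schwartzNorm {ds du : ℕ} (χ : Cutoff) (r : ℝ) {C : ConePair ds du}
    (hC : C.HorizontalSubset) (CF : ℝ) {p : ℝ≥0∞} (hp : 1 ≤ p) (t : ℝ) {s : ℝ} (hs : s ≤ 0) :
    ∃ (N : ℕ) (D : ℝ), 0 ≤ D ∧ ∀ f : 𝓢(Ambient ds du, ℂ),
      (uENorm χ r C CF p t s f).toReal ≤ D * schwartzNorm N f := by
  obtain ⟨A, hA⟩ := C.exists_lipschitz hC
  obtain ⟨N, H, hH, hf⟩ := lpOp_decay_uniform (V := Ambient ds du) χ t (ds + 1)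
  obtain ⟨B, hB, hk⟩ := lpKernel_decay (V := EuclideanSpace ℝ (Fin ds)) χ (ds + 1)
  set Q := eLpNorm (fun z : EuclideanSpace ℝ (Fin ds) => weight (ds + 1) z) p
        (((A : ℝ≥0∞) ^ (ds : ℝ)) • volume) with hQ
  have hQt : Q < ⊤ := ((memLp_weight p hp).smul_measure
    (ENNReal.rpow_ne_top_of_nonneg (by positivity) ENNReal.coe_ne_top)).2
  refine ⟨N, B * H * Q.toReal, by positivity, fun f => ?_⟩
  have hS0 : 0 ≤ schwartzNorm N f := apply_nonneg _ _
  have hHf : 0 ≤ H * schwartzNorm N f := by positivity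
  have hmain : uENorm χ r C CF p t s f ≤ ENNReal.ofReal (B * (H * schwartzNorm N f)) * Q := by
    refine iSup_le fun Γ => iSup_le fun hΓ => iSup_le fun l => ?_
    rw [leafNorm, ENNReal.mul_iSup]
    refine iSup_le fun n => ?_
    have ht : (0 : ℝ) < (2 : ℝ) ^ ((l : ℝ) * t) := by positivity
    set H' := H * schwartzNorm N f / (2 : ℝ) ^ ((l : ℝ) * t) with hH'
    have hH'0 : 0 ≤ H' := by positivity
    have h1 : ∀ x, ‖lpOp χ l f x‖ * (1 + ‖x‖) ^ (ds + 1) ≤ H' := by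
      intro x
      rw [hH', le_div_iff₀ ht]
      linarith [hf f l x]
    have h2 := eLpNorm_leaf_le hΓ.isLocallyClosed (hA r CF Γ hΓ) hp
      (g := leafOp χ n Γ (lpOp χ l f)) (H := B * H')
      (fun w => hk n _ H' hH'0 (leafPull_decay Γ _ hH'0 h1) _)
    -- As `s ≤ 0`, a bound on the leafwise pieces that is uniform in `n` is enough.
    have h3 : ENNReal.ofReal ((2 : ℝ) ^ ((n : ℝ) * s)) ≤ 1 := by
      rw [ENNReal.ofReal_le_one]
      exact Real.rpow_le_one_of_one_le_of_nonpos one_le_two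
        (mul_nonpos_of_nonneg_of_nonpos (by positivity) hs)
    calc _ ≤ ENNReal.ofReal ((2 : ℝ) ^ ((l : ℝ) * t)) *
          (1 * (ENNReal.ofReal (B * H') * Q)) := by
          gcongr
      _ = ENNReal.ofReal ((2 : ℝ) ^ ((l : ℝ) * t) * (B * H')) * Q := by
          rw [one_mul, ← mul_assoc, ← ENNReal.ofReal_mul ht.le]
      _ = _ := by
          congr 2
          rw [hH']
          field_simp
  refine (ENNReal.toReal_mono (ENNReal.mul_ne_top ENNReal.ofReal_ne_top hQt.ne) hmain).trans
    (le_of_eq ?_)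
  rw [ENNReal.toReal_mul, ENNReal.toReal_ofReal (by positivity)]
  ring

/-! ### Affine leaves -/

section AffineLeaves

/-- The first derivative is a constant isometry and the higher ones vanish. Since `r > 1`, the
Hölder condition concerns a derivative of order at least one, which is constant; values of the map
itself, hence `w`, are not bounded by `CrBound`. -/
theorem crBound_isometry_add {V W : Type*} [NormedAddCommGroup V] [NormedSpace ℝ V]
    [NormedAddCommGroup W] [NormedSpace ℝ W] (I : V →ₗᵢ[ℝ] W) (w : W) {r c : ℝ} (hr : 1 < r)
    (hc : 1 ≤ c) (U : Set V) : CrBound r c (fun x => I x + w) U := by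
  have hd : fderiv ℝ (fun x => I x + w) = fun _ => I.toContinuousLinearMap := by
    ext1 x
    exact (I.toContinuousLinearMap.hasFDerivAt.add_const w).fderiv
  refine ⟨?_, ?_, ?_⟩
  · exact (I.toContinuousLinearMap.contDiff.add contDiff_const).contDiffOn
  · intro j hj _ x _
    obtain ⟨j, rfl⟩ : ∃ k, j = k + 1 := ⟨j - 1, by omega⟩
    rw [← norm_iteratedFDeriv_fderiv, hd]
    rcases j with _ | j
    · rw [norm_iteratedFDeriv_zero]
      exact I.norm_toContinuousLinearMap_le.trans hc
    · rw [iteratedFDeriv_succ_const]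
      simp only [Pi.zero_apply, norm_zero]
      linarith
  · intro _ x _ y _
    obtain ⟨j, hj⟩ : ∃ k, ⌊r⌋₊ = k + 1 := ⟨⌊r⌋₊ - 1, by
      have : 1 ≤ ⌊r⌋₊ := Nat.le_floor (by simpa using hr.le)
      omega⟩
    have : iteratedFDeriv ℝ ⌊r⌋₊ (fun x => I x + w) x =
        iteratedFDeriv ℝ ⌊r⌋₊ (fun x => I x + w) y := by
      rw [hj]
      simp only [iteratedFDeriv_succ_eq_comp_right, hd, Function.comp_apply]
      rcases j with _ | j
      · simp only [iteratedFDeriv_zero_eq_comp, Function.comp_apply]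
      · simp only [iteratedFDeriv_succ_const, Pi.zero_apply]
    rw [this, sub_self, norm_zero]
    have := norm_nonneg (x - y)
    positivity

variable {ds du : ℕ}

theorem finrank_ker_projU : Module.finrank ℝ (LinearMap.ker (projU ds du)) = ds := by
  have hs : Function.Surjective (projU ds du) := by
    intro y
    exact ⟨WithLp.toLp 2 (Sum.elim (fun _ => 0) fun i => y i), by ext i; rfl⟩
  have h1 := LinearMap.finrank_range_add_finrank_ker (projU ds du)
  rw [LinearMap.range_eq_top.2 hs, finrank_top] at h1
  simp at h1
  omega

/-- The isometry straightens `W` to the horizontal space and serves as the chart of a leaf parallel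
to `W`. It extends to the whole space an isometry of `W` onto `ker π_+`. -/
theorem exists_isometry_of_finrank {W : Submodule ℝ (Ambient ds du)}
    (hW : Module.finrank ℝ W = ds) :
    ∃ I : Ambient ds du ≃ₗᵢ[ℝ] Ambient ds du, ∀ x, projU ds du (I x) = 0 ↔ x ∈ W := by
  set U := LinearMap.ker (projU ds du)
  have e : W ≃ₗᵢ[ℝ] U := (stdOrthonormalBasis ℝ W).equiv (stdOrthonormalBasis ℝ U)
    (finCongr (hW.trans finrank_ker_projU.symm))
  set J : W →ₗᵢ[ℝ] Ambient ds du := U.subtypeₗᵢ.comp e.toLinearIsometry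
  refine ⟨J.extend.toLinearIsometryEquiv rfl, fun x => ⟨fun hx => ?_, fun hx => ?_⟩⟩
  · have hx' : J.extend x ∈ U := hx
    have h1 : J.extend (e.symm ⟨J.extend x, hx'⟩ : W) = J.extend x := by
      rw [LinearIsometry.extend_apply]
      simp [J]
    rw [← J.extend.injective h1]
    exact (e.symm _).2
  · have h1 : J.extend x = J ⟨x, hx⟩ := LinearIsometry.extend_apply J ⟨x, hx⟩
    change projU ds du (J.extend x) = 0
    rw [h1]
    exact (e ⟨x, hx⟩).2

/-- Differences of points of the plane are normal to `L`, and a translation followed by an isometry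
is a global chart whose `C^r` bounds are at most `1 ≤ CF`. -/
theorem isFakeLeaf_affine {Cp : Set (Ambient ds du)} {L : Submodule ℝ (Ambient ds du)}
    (hL : (L : Set (Ambient ds du)) ⊆ Cp) (hLd : Module.finrank ℝ L = du) {r CF : ℝ} (hr : 1 < r)
    (hCF : 1 ≤ CF) (x : Ambient ds du) : IsFakeLeaf r Cp CF {y | y - x ∈ Lᗮ} := by
  have hW : Module.finrank ℝ Lᗮ = ds := by
    have := L.finrank_add_finrank_orthogonal
    simp [hLd] at this
    omega
  obtain ⟨I, hI⟩ := exists_isometry_of_finrank hW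
  refine ⟨fun w hw => ?_, fun y hy z hz _ => ⟨L, hLd, hL, fun l hl => ?_⟩⟩
  · refine ⟨((Homeomorph.subRight x).trans I.toHomeomorph).toOpenPartialHomeomorph, by simp,
      fun y _ => (hI (y - x)).symm, ?_, ?_⟩
    · have h1 : (fun y => I (y - x)) = fun y => I.toLinearIsometry y + -I x := by
        ext1 y
        rw [map_sub, sub_eq_add_neg]
        rfl
      have h2 := crBound_isometry_add I.toLinearIsometry (-I x) hr hCF Set.univ
      rw [← h1] at h2
      exact h2
    · exact crBound_isometry_add I.symm.toLinearIsometry x hr hCF Set.univ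
  · have h1 : y - z ∈ Lᗮ := by
      have := Lᗮ.sub_mem hy hz
      simpa using this
    rw [real_inner_comm]
    exact h1 l hl

/-- There is a family of parallel affine leaves, all of them graphs of affine maps. -/
theorem ConePair.exists_affine_leaves (C : ConePair ds du) (hC : C.HorizontalSubset) :
    ∃ B : EuclideanSpace ℝ (Fin ds) →L[ℝ] Ambient ds du, (∀ z, projS ds du (B z) = z) ∧
      ∀ r : ℝ, 1 < r → ∀ CF : ℝ, 1 ≤ CF → ∀ x,
        IsFakeLeaf r C.plus CF (Set.range fun z => x + B z) := by
  obtain ⟨L, hL, hLd⟩ := C.dim_plus.2.1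
  have hW : Module.finrank ℝ Lᗮ = ds := by
    have := L.finrank_add_finrank_orthogonal
    simp [hLd] at this
    omega
  obtain ⟨A, hA⟩ := C.exists_lipschitz hC
  -- The Lipschitz estimate for leaves, applied to `Lᗮ` itself, makes `π_-` injective on it, hence
  -- bijective by dimension; `B` is the inverse. The values `2` and `1` are arbitrary, as the
  -- constant `A` depends only on the cone.
  have h0 := hA 2 1 _ (isFakeLeaf_affine hL hLd one_lt_two le_rfl 0)
  set P : Lᗮ →ₗ[ℝ] EuclideanSpace ℝ (Fin ds) := (projS ds du).domRestrict Lᗮ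
  have hinj : Function.Injective P := by
    intro y z hyz
    have hyz' : projS ds du y = projS ds du z := hyz
    have := h0 y (by simp) z (by simp)
    rw [hyz', sub_self, norm_zero, mul_zero] at this
    exact Subtype.ext (sub_eq_zero.1 (norm_le_zero_iff.1 this))
  set e := LinearEquiv.ofInjectiveOfFinrankEq P hinj (by simp [hW])
  have he : ∀ y, e y = projS ds du y := fun y => rfl
  refine ⟨(Lᗮ.subtype ∘ₗ e.symm.toLinearMap).toContinuousLinearMap, fun z => ?_,
    fun r hr CF hCF x => ?_⟩
  · change projS ds du (e.symm z : Lᗮ) = z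
    rw [← he, e.apply_symm_apply]
  · convert isFakeLeaf_affine hL hLd hr hCF x using 1
    ext y
    constructor
    · rintro ⟨z, rfl⟩
      simp
    · intro hy
      refine ⟨e ⟨y - x, hy⟩, ?_⟩
      change x + ((e.symm (e ⟨y - x, hy⟩) : Lᗮ) : Ambient ds du) = y
      simp

end AffineLeaves

/-! ### Reproducing band-limited functions along affine subspaces -/

section Reproducing

variable {V : Type*} [NormedAddCommGroup V] [InnerProductSpace ℝ V]
  [FiniteDimensional ℝ V] [MeasurableSpace V] [BorelSpace V]

theorem lpSymbol_eq_zero (χ : Cutoff) {n : ℕ} {ξ : V} (h : (2 : ℝ) ^ (n + 1) ≤ ‖ξ‖) :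
    lpSymbol χ n ξ = 0 := by
  rcases Nat.eq_zero_or_pos n with rfl | hn
  · rw [lpSymbol_zero]
    exact χ.eq_zero _ (by simpa using h)
  · have h2 : (2 : ℝ) ^ (-(n : ℤ)) * 2 ^ (n + 1) = 2 := by
      rw [zpow_neg, zpow_natCast, pow_succ, ← mul_assoc, inv_mul_cancel₀ (by positivity), one_mul]
    have h3 : 2 ≤ (2 : ℝ) ^ (-(n : ℤ)) * ‖ξ‖ := by
      calc (2 : ℝ) = (2 : ℝ) ^ (-(n : ℤ)) * 2 ^ (n + 1) := h2.symm
        _ ≤ _ := by gcongr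
    rw [lpSymbol, if_neg hn.ne', χ.eq_zero _ h3, χ.eq_zero, sub_zero]
    rw [zpow_add₀ two_ne_zero]
    simp only [zpow_one]
    nlinarith

/-- The sum telescopes to `χ(2^{-N}‖ξ‖)`. -/
theorem sum_lpSymbol (χ : Cutoff) (N : ℕ) (ξ : V) :
    ∑ n ∈ Finset.range (N + 1), lpSymbol χ n ξ = lpSymbol χ 0 (((2 : ℝ) ^ N)⁻¹ • ξ) := by
  induction N with
  | zero => simp
  | succ N ih =>
    rw [Finset.sum_range_succ, ih, lpSymbol_zero, lpSymbol_zero, lpSymbol, if_neg (by simp),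
      norm_smul, norm_smul, Real.norm_of_nonneg (by positivity), Real.norm_of_nonneg (by positivity)]
    have e1 : (2 : ℝ) ^ (-((N + 1 : ℕ) : ℤ)) = ((2 : ℝ) ^ (N + 1))⁻¹ := by
      rw [zpow_neg, zpow_natCast]
    have e2 : (2 : ℝ) ^ (-((N + 1 : ℕ) : ℤ) + 1) = ((2 : ℝ) ^ N)⁻¹ := by
      rw [zpow_add₀ two_ne_zero, e1, pow_succ]
      field_simp
    rw [e1, e2]
    ring_nf

theorem sum_invFourier_lpSymbol (χ : Cutoff) (N : ℕ) (x : V) :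
    ∑ n ∈ Finset.range (N + 1), invFourier (lpSymbol χ n) x =
      invFourier (fun ξ => lpSymbol χ 0 (((2 : ℝ) ^ N)⁻¹ • ξ)) x := by
  simp only [invFourier]
  rw [← Finset.mul_sum, ← integral_finsetSum]
  · simp only [← Finset.mul_sum, ← sum_lpSymbol, Complex.ofReal_sum]
  · intro n _
    have h1 := hasCompactSupport_lpSymbol (V := V) χ n
    have h2 := contDiff_lpSymbol (V := V) χ n
    have h3 : HasCompactSupport fun ξ : V => ((lpSymbol χ n ξ : ℝ) : ℂ) :=
      h1.comp_left (g := fun x : ℝ => (x : ℂ)) (by simp)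
    refine Continuous.integrable_of_hasCompactSupport ?_ h3.mul_left
    have := h2.continuous
    fun_prop

open FourierTransform in
theorem fourier_lpOp (χ : Cutoff) (n : ℕ) (f : 𝓢(V, ℂ)) (ζ : V) :
    𝓕 (lpOp χ n f) ζ = ((lpSymbol χ n ((2 * Real.pi) • ζ) : ℝ) : ℂ) * 𝓕 f ζ := by
  have hg : Function.HasTemperateGrowth (fun ζ : V => ((lpSymbol χ n ((2 * Real.pi) • ζ) : ℝ) : ℂ)) :=
    (symbolS _ (hasCompactSupport_lpSymbol χ n) (contDiff_lpSymbol χ n)).hasTemperateGrowth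
  rw [lpOp, SchwartzMap.fourierMultiplierCLM_apply, FourierTransform.fourier_fourierInv_eq,
    SchwartzMap.smulLeftCLM_apply_apply hg, smul_eq_mul]

variable {E : Type*} [NormedAddCommGroup E] [InnerProductSpace ℝ E]
  [FiniteDimensional ℝ E] [MeasurableSpace E] [BorelSpace E]

open FourierTransform in
theorem integral_invFourier_exp (a : E → ℝ) (h1 : HasCompactSupport a) (h2 : ContDiff ℝ ∞ a)
    (ω' : E) : ∫ z, Complex.exp (((-2 * Real.pi * inner ℝ z ω' : ℝ) : ℂ) * Complex.I) *
      invFourier a z = ((a ((2 * Real.pi) • ω') : ℝ) : ℂ) := by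
  have h : 𝓕 (𝓕⁻ (symbolS a h1 h2)) ω' = symbolS a h1 h2 ω' := by
    rw [FourierTransform.fourier_fourierInv_eq]
  rw [SchwartzMap.fourier_coe, Real.fourier_eq'] at h
  simp only [invFourier_eq_schwartz a h1 h2]
  simp only [smul_eq_mul] at h
  rw [h]
  rfl

open FourierTransform in
/-- A band-limited function is reproduced along affine subspaces by kernels whose symbol is `1` on
the projection of its spectrum. -/
theorem integral_kernel_affine (B : E →L[ℝ] V) (a : E → ℝ) (h1 : HasCompactSupport a)
    (h2 : ContDiff ℝ ∞ a) (f : 𝓢(V, ℂ))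
    (hf : ∀ ζ, 𝓕 f ζ ≠ 0 → a ((2 * Real.pi) • B.adjoint ζ) = 1) (x : V) (z : E) :
    ∫ z', invFourier a (z - z') * f (x + B z') = f (x + B z) := by
  have hinv : ∀ y, f y = ∫ ζ, Complex.exp (((2 * Real.pi * inner ℝ ζ y : ℝ) : ℂ) * Complex.I) *
      𝓕 f ζ := by
    intro y
    have : f y = (𝓕⁻ (𝓕 f) : 𝓢(V, ℂ)) y := by rw [FourierTransform.fourierInv_fourier_eq]
    rw [this, SchwartzMap.fourierInv_coe, Real.fourierInv_eq']
    rfl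
  have hk : Integrable (invFourier a) := by
    rw [funext (invFourier_eq_schwartz a h1 h2)]
    exact SchwartzMap.integrable _
  have hkc : Continuous (invFourier a) := by
    rw [funext (invFourier_eq_schwartz a h1 h2)]
    exact SchwartzMap.continuous _
  have hc : Continuous (𝓕 f : 𝓢(V, ℂ)) := (𝓕 f : 𝓢(V, ℂ)).continuous
  have e1 : ∫ z', invFourier a (z - z') * f (x + B z') =
      ∫ z', invFourier a z' * f (x + B (z - z')) := by
    rw [← integral_sub_left_eq_self _ volume z]
    simp
  -- Fourier inversion of `f` at `x + B (z - z')` separates the variables: the integral of `G` over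
  -- `z'` is the Fourier transform of the kernel at `B* ζ`, that is `a(2π B* ζ)`, which equals `1`
  -- wherever `𝓕 f ζ ≠ 0`.
  set G : E → V → ℂ := fun z' ζ => (Complex.exp (((-2 * Real.pi *
    inner ℝ z' (B.adjoint ζ) : ℝ) : ℂ) * Complex.I) * invFourier a z') *
    (Complex.exp (((2 * Real.pi * inner ℝ ζ (x + B z) : ℝ) : ℂ) * Complex.I) * 𝓕 f ζ) with hG
  have e2 : ∀ z', invFourier a z' * f (x + B (z - z')) = ∫ ζ, G z' ζ := by
    intro z'
    rw [hinv, ← integral_const_mul]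
    refine integral_congr_ae (Filter.Eventually.of_forall fun ζ => ?_)
    have : Complex.exp (((2 * Real.pi * inner ℝ ζ (x + B (z - z')) : ℝ) : ℂ) * Complex.I) =
        Complex.exp (((-2 * Real.pi * inner ℝ z' (B.adjoint ζ) : ℝ) : ℂ) * Complex.I) *
        Complex.exp (((2 * Real.pi * inner ℝ ζ (x + B z) : ℝ) : ℂ) * Complex.I) := by
      rw [← Complex.exp_add]
      congr 1
      rw [ContinuousLinearMap.adjoint_inner_right, map_sub, inner_add_right, inner_add_right,
        inner_sub_right, real_inner_comm (B z') ζ]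
      push_cast
      ring
    simp only [hG]
    rw [this]
    ring
  have hint : Integrable (Function.uncurry G) (volume.prod volume) := by
    have hp : Integrable (fun p : E × V => invFourier a p.1 * 𝓕 f p.2) (volume.prod volume) :=
      hk.mul_prod (𝓕 f).integrable
    refine hp.mono (Continuous.aestronglyMeasurable ?_) (Filter.Eventually.of_forall fun p => ?_)
    · simp only [hG, Function.uncurry_def]
      fun_prop
    · simp only [hG, Function.uncurry_def, norm_mul, Complex.norm_exp_ofReal_mul_I, one_mul]
      exact le_rfl
  rw [e1]
  simp only [e2]
  rw [integral_integral_swap hint, hinv (x + B z)]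
  refine integral_congr_ae (Filter.Eventually.of_forall fun ζ => ?_)
  simp only [hG]
  rw [integral_mul_const, integral_invFourier_exp a h1 h2]
  by_cases h0 : 𝓕 f ζ = 0
  · simp [h0]
  · rw [hf ζ h0]
    simp

end Reproducing

/-! ### Pointwise bounds for the Littlewood-Paley pieces -/

section SupBound

variable {ds du : ℕ}

/-- The symbol `χ(2^{-N} ‖ξ‖)` of the sum of the first pieces. -/
def lowSymbol {V : Type*} [NormedAddCommGroup V] [InnerProductSpace ℝ V] (χ : Cutoff) (N : ℕ)
    (ξ : V) : ℝ :=
  lpSymbol χ 0 (((2 : ℝ) ^ N)⁻¹ • ξ)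

theorem hasCompactSupport_lowSymbol {V : Type*} [NormedAddCommGroup V] [InnerProductSpace ℝ V]
    [FiniteDimensional ℝ V] [MeasurableSpace V] [BorelSpace V] (χ : Cutoff) (N : ℕ) :
    HasCompactSupport (lowSymbol (V := V) χ N) :=
  (hasCompactSupport_lpSymbol χ 0).comp_homeomorph
    (Homeomorph.smulOfNeZero (((2 : ℝ) ^ N)⁻¹) (by positivity))

theorem contDiff_lowSymbol {V : Type*} [NormedAddCommGroup V] [InnerProductSpace ℝ V]
    [FiniteDimensional ℝ V] [MeasurableSpace V] [BorelSpace V] (χ : Cutoff) (N : ℕ) :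
    ContDiff ℝ ∞ (lowSymbol (V := V) χ N) :=
  (contDiff_lpSymbol χ 0).comp (by fun_prop)

/-- Dilation by `2^N` produces the Jacobian `2^{N d_s}`, and decay in `2^N v` implies decay in `v`.
The weight lies in every `L_q`, so this bounds the kernel in the dual exponent. -/
theorem norm_invFourier_lowSymbol_le (χ : Cutoff) : ∃ H : ℝ, 0 ≤ H ∧
    ∀ (N : ℕ) (v : EuclideanSpace ℝ (Fin ds)),
      ‖invFourier (lowSymbol χ N) v‖ ≤ H * 2 ^ (N * ds) * weight (ds + 1) v := by
  obtain ⟨H, hH, h⟩ := schwartz_decay (FourierTransformInv.fourierInv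
    (symbolS (V := EuclideanSpace ℝ (Fin ds)) _ (hasCompactSupport_lpSymbol χ 0)
      (contDiff_lpSymbol χ 0)) : 𝓢(EuclideanSpace ℝ (Fin ds), ℂ)) (ds + 1)
  refine ⟨H, hH, fun N v => ?_⟩
  have h1 := h ((2 : ℝ) ^ N • v)
  rw [← invFourier_eq_schwartz] at h1
  have hc : (0 : ℝ) < 2 ^ N := by positivity
  have e : invFourier (lowSymbol χ N) v = _ :=
    invFourier_dilate (V := EuclideanSpace ℝ (Fin ds)) (lpSymbol χ 0) hc v
  rw [e, norm_mul, Complex.norm_real, Real.norm_of_nonneg (by positivity), finrank_euclideanSpace,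
    Fintype.card_fin, ← pow_mul]
  have h2 : ‖invFourier (lpSymbol χ 0) ((2 : ℝ) ^ N • v)‖ * (1 + ‖v‖) ^ (ds + 1) ≤ H := by
    refine le_trans ?_ h1
    gcongr
    rw [norm_smul, Real.norm_of_nonneg hc.le]
    exact le_mul_of_one_le_left (norm_nonneg _) (one_le_pow₀ one_le_two)
  have h3 : ‖invFourier (lpSymbol χ 0) ((2 : ℝ) ^ N • v)‖ ≤ H * weight (ds + 1) v := by
    rw [weight, Real.rpow_neg (by positivity), ← div_eq_mul_inv, le_div_iff₀ (by positivity),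
      Real.rpow_natCast]
    exact h2
  calc _ ≤ 2 ^ (N * ds) * (H * weight (ds + 1) v) := by gcongr
    _ = _ := by ring

/-- The projection is 1-Lipschitz and so does not increase Hausdorff measure. This is the
counterpart of `leafMeasure_map_le`. -/
theorem volume_le_map_leafMeasure {Γ : Set (Ambient ds du)} (hΓ : projS ds du '' Γ = Set.univ) :
    (volume : Measure (EuclideanSpace ℝ (Fin ds))) ≤ (leafMeasure Γ).map (projS ds du) := by
  refine Measure.le_iff.2 fun S hS => ?_
  have hpre : MeasurableSet (projS ds du ⁻¹' S) := continuous_projS.measurable hS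
  rw [Measure.map_apply continuous_projS.measurable hS, leafMeasure,
    Measure.restrict_apply hpre, ← EuclideanSpace.euclideanHausdorffMeasure_eq_volume]
  have hlip : LipschitzWith 1 (projS ds du) := LipschitzWith.of_dist_le_mul fun x y => by
    rw [dist_eq_norm, dist_eq_norm, ← map_sub, NNReal.coe_one, one_mul]
    exact norm_projS_le _
  have himg : projS ds du '' (projS ds du ⁻¹' S ∩ Γ) = S := by
    rw [Set.inter_comm, Set.image_inter_preimage, hΓ, Set.univ_inter]
  have h1 := hlip.hausdorffMeasure_image_le (d := (ds : ℝ)) (by positivity)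
    (projS ds du ⁻¹' S ∩ Γ)
  rw [himg, ENNReal.coe_one, ENNReal.one_rpow, one_mul] at h1
  simp only [Measure.euclideanHausdorffMeasure_def, Measure.smul_apply, ENNReal.smul_def,
    smul_eq_mul]
  exact mul_le_mul_right h1 _

variable {B : EuclideanSpace ℝ (Fin ds) →L[ℝ] Ambient ds du}

theorem leafPull_affine (hB : ∀ z, projS ds du (B z) = z) {x : Ambient ds du}
    (hx : projS ds du x = 0) (f : Ambient ds du → ℂ) (z : EuclideanSpace ℝ (Fin ds)) :
    leafPull (Set.range fun z => x + B z) f z = f (x + B z) := by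
  have h := leafPull_of_mem (A := ‖B‖) (Γ := Set.range fun z => x + B z) (by
    rintro _ ⟨z, rfl⟩ _ ⟨z', rfl⟩
    have e : x + B z - (x + B z') = B (z - z') := by rw [map_sub]; abel
    simp only [e, map_add, hx, hB, zero_add]
    exact B.le_opNorm _) f ⟨z, rfl⟩
  simpa [hx, hB] using h

/-- On an affine leaf `leafOp` factors through `π_-`, so its norm is taken for the image of `μ_Γ`,
which dominates Lebesgue measure. -/
theorem eLpNorm_affine_le (χ : Cutoff) (hB : ∀ z, projS ds du (B z) = z) {x : Ambient ds du}
    (hx : projS ds du x = 0) (p : ℝ≥0∞) (n : ℕ) (f : Ambient ds du → ℂ)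
    (hc : Continuous fun z => ∫ z', invFourier (lpSymbol χ n) (z - z') * f (x + B z')) :
    eLpNorm (fun z => ∫ z', invFourier (lpSymbol χ n) (z - z') * f (x + B z')) p volume ≤
      eLpNorm (leafOp χ n (Set.range fun z => x + B z) f) p
        (leafMeasure (Set.range fun z => x + B z)) := by
  set Γ := Set.range fun z => x + B z with hΓ
  have e : leafOp χ n Γ f =
      (fun z => ∫ z', invFourier (lpSymbol χ n) (z - z') * f (x + B z')) ∘ projS ds du := by
    ext w
    simp only [leafOp, Function.comp, hΓ, leafPull_affine hB hx]
  rw [e, ← eLpNorm_map_measure hc.aestronglyMeasurable continuous_projS.aemeasurable]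
  refine eLpNorm_mono_measure _ (volume_le_map_leafMeasure ?_)
  refine Set.eq_univ_of_forall fun z => ⟨x + B z, ⟨z, rfl⟩, ?_⟩
  rw [map_add, hx, hB, zero_add]

open FourierTransform in
-- The spectrum of `ψ_l^{Op} u` satisfies `‖ξ‖ < 2^{l+1}`, and `B*` enlarges norms by at most `2^c`,
-- so its image stays where `χ(2^{-(c+l+1)}‖·‖) = 1`.
theorem lowSymbol_adjoint_eq_one (χ : Cutoff) (B : EuclideanSpace ℝ (Fin ds) →L[ℝ] Ambient ds du)
    {c : ℕ} (hc : ‖B‖ ≤ 2 ^ c) (l : ℕ) (u : 𝓢(Ambient ds du, ℂ)) (ζ : Ambient ds du)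
    (hζ : 𝓕 (lpOp χ l u) ζ ≠ 0) :
    lowSymbol χ (c + (l + 1)) ((2 * Real.pi) • B.adjoint ζ) = 1 := by
  rw [fourier_lpOp] at hζ
  have h1 : ‖(2 * Real.pi) • ζ‖ < 2 ^ (l + 1) := by
    by_contra h
    rw [lpSymbol_eq_zero χ (not_lt.1 h)] at hζ
    simp at hζ
  rw [lowSymbol, lpSymbol_zero]
  refine χ.eq_one _ ?_
  rw [one_mul, norm_smul, Real.norm_of_nonneg (by positivity), inv_mul_le_iff₀ (by positivity),
    mul_one, ← map_smul, pow_add]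
  refine (B.adjoint.le_opNorm _).trans ?_
  rw [LinearIsometryEquiv.norm_map]
  gcongr

/-- The Littlewood-Paley pieces are bounded pointwise by the anisotropic norm. -/
theorem exists_norm_lpOp_le (χ : Cutoff) {r : ℝ} (hr : 1 < r) {C : ConePair ds du}
    (hC : C.HorizontalSubset) {CF : ℝ} (hCF : 1 ≤ CF) {p : ℝ≥0∞} (hp : 1 ≤ p) {t s : ℝ}
    (ht : 0 ≤ t) (hs : s ≤ 0) :
    ∃ (b : ℕ) (D : ℝ), 0 ≤ D ∧ ∀ (u : 𝓢(Ambient ds du, ℂ)) (l : ℕ) (x : Ambient ds du),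
      ‖lpOp χ l u x‖ ≤ D * (2 ^ l) ^ b * (uENorm χ r C CF p t s u).toReal := by
  obtain ⟨B, hB, hleaf⟩ := C.exists_affine_leaves hC
  obtain ⟨c, hc⟩ := pow_unbounded_of_one_lt ‖B‖ (one_lt_two (α := ℝ))
  obtain ⟨H, hH, hk⟩ := norm_invFourier_lowSymbol_le (ds := ds) χ
  obtain ⟨m, hm⟩ := exists_nat_ge (-s)
  set q := ENNReal.conjExponent p
  have : ENNReal.HolderConjugate p q := ENNReal.HolderConjugate.conjExponent hp
  have : ENNReal.HolderConjugate q p := ENNReal.HolderConjugate.symm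
  have hq : 1 ≤ q := ENNReal.HolderConjugate.one_le q p
  set W := eLpNorm (fun z : EuclideanSpace ℝ (Fin ds) => weight (ds + 1) z) q volume with hWdef
  have hW : W < ⊤ := (memLp_weight q hq).2
  -- Powers of `2^N = 2^{c+1} 2^l`: one for the number `N + 1` of pieces, `d_s` for the size of the
  -- kernel, `m ≥ -s` for the weights `2^{-ns}` with `n ≤ N`.
  set b := 1 + ds + m with hb
  refine ⟨b, (2 ^ (c + 1)) ^ b * H * W.toReal, by positivity, fun u l y => ?_⟩
  set N := c + (l + 1) with hN
  set f := lpOp χ l u with hf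
  -- The base point of the leaf through `y` is moved to the fibre over `0`, so that `z` itself is
  -- the `π_-`-coordinate of `x + B z`.
  set x := y - B (projS ds du y) with hxdef
  have hx : projS ds du x = 0 := by rw [hxdef, map_sub, hB, sub_self]
  set z₀ := projS ds du y with hz₀
  have hy : x + B z₀ = y := by rw [hxdef, sub_add_cancel]
  set Γ := Set.range fun z => x + B z with hΓ
  have hΓl : IsFakeLeaf r C.plus CF Γ := hleaf r hr CF hCF x
  obtain ⟨A, hA⟩ := C.exists_lipschitz hC
  have hfi : Integrable (leafPull Γ f) :=
    integrable_leafPull hΓl.isLocallyClosed (hA r CF Γ hΓl) f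
  have hfi' : Integrable (fun z => f (x + B z)) := by
    have : leafPull Γ f = fun z => f (x + B z) := funext fun z => leafPull_affine hB hx f z
    rwa [this] at hfi
  set F : ℕ → EuclideanSpace ℝ (Fin ds) → ℂ := fun n z =>
    ∫ z', invFourier (lpSymbol χ n) (z - z') * f (x + B z') with hF
  have hFc : ∀ n, Continuous (F n) := by
    intro n
    have h1 : F n = fun z => leafOp χ n Γ f (x + B z) := by
      ext z
      simp only [hF, leafOp, hΓ, leafPull_affine hB hx, map_add, hx, hB, zero_add]
    rw [h1]
    exact (continuous_leafOp χ n hfi).comp (by fun_prop)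
  set k : EuclideanSpace ℝ (Fin ds) → ℂ := invFourier (lowSymbol χ N) with hkdef
  have hkc : Continuous k := by
    have e : k = _ := funext (invFourier_eq_schwartz _ (hasCompactSupport_lowSymbol χ N)
      (contDiff_lowSymbol χ N))
    rw [e]
    exact SchwartzMap.continuous _
  have hrep : ∀ z, ∫ z', k (z - z') * f (x + B z') = f (x + B z) := fun z =>
    integral_kernel_affine B (lowSymbol χ N) (hasCompactSupport_lowSymbol χ N)
      (contDiff_lowSymbol χ N) f (lowSymbol_adjoint_eq_one χ B hc.le l u) x z
  -- First use of the reproducing formula: its kernel is the sum of the leafwise kernels of index at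
  -- most `N`, so along the leaf `f` is a finite sum of the pieces that the norm controls.
  have hsum : ∀ z, f (x + B z) = ∑ n ∈ Finset.range (N + 1), F n z := by
    intro z
    rw [← hrep z]
    simp only [hF]
    rw [← integral_finsetSum _ fun n _ => integrable_kernel_mul χ n hfi' z]
    refine integral_congr_ae (Filter.Eventually.of_forall fun z' => ?_)
    simp only
    rw [← Finset.sum_mul, sum_invFourier_lpSymbol]
    rfl
  set U := uENorm χ r C CF p t s u with hU
  have hUt : U < ⊤ := uENorm_lt_top χ r C CF p t s hC hp hs u
  have hFn : ∀ n ∈ Finset.range (N + 1), eLpNorm (F n) p volume ≤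
      ENNReal.ofReal ((2 : ℝ) ^ (N * m)) * U := by
    intro n hn
    have h1 := eLpNorm_affine_le χ hB hx p n f (hFc n)
    have h2 : ENNReal.ofReal ((2 : ℝ) ^ ((l : ℝ) * t)) *
        (ENNReal.ofReal ((2 : ℝ) ^ ((n : ℝ) * s)) * eLpNorm (leafOp χ n Γ f) p (leafMeasure Γ)) ≤
        U := by
      refine le_trans ?_ (le_iSup_of_le Γ (le_iSup_of_le hΓl (le_iSup_of_le l le_rfl)))
      gcongr
      exact le_iSup (fun n : ℕ => ENNReal.ofReal ((2 : ℝ) ^ ((n : ℝ) * s)) *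
        eLpNorm (leafOp χ n Γ f) p (leafMeasure Γ)) n
    refine h1.trans ?_
    -- The weights of the norm are removed: `n ≤ N` and `-s ≤ m` give `-ns ≤ Nm`, and `t ≥ 0`.
    have h3 : (1 : ℝ≥0∞) ≤ ENNReal.ofReal ((2 : ℝ) ^ (N * m)) *
        (ENNReal.ofReal ((2 : ℝ) ^ ((l : ℝ) * t)) * ENNReal.ofReal ((2 : ℝ) ^ ((n : ℝ) * s))) := by
      rw [← ENNReal.ofReal_mul (by positivity), ← ENNReal.ofReal_mul (by positivity),
        ← Real.rpow_natCast, ← Real.rpow_add two_pos, ← Real.rpow_add two_pos,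
        ENNReal.one_le_ofReal]
      refine Real.one_le_rpow one_le_two ?_
      have hnN : (n : ℝ) ≤ N := by exact_mod_cast Nat.lt_succ_iff.1 (Finset.mem_range.1 hn)
      have h4 : (n : ℝ) * (-s) ≤ N * m := mul_le_mul hnN hm (by linarith) (by positivity)
      have h5 : 0 ≤ (l : ℝ) * t := by positivity
      push_cast
      linarith
    calc eLpNorm (leafOp χ n Γ f) p (leafMeasure Γ)
        ≤ (ENNReal.ofReal ((2 : ℝ) ^ (N * m)) *
          (ENNReal.ofReal ((2 : ℝ) ^ ((l : ℝ) * t)) * ENNReal.ofReal ((2 : ℝ) ^ ((n : ℝ) * s)))) *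
          eLpNorm (leafOp χ n Γ f) p (leafMeasure Γ) := le_mul_of_one_le_left bot_le h3
      _ = ENNReal.ofReal ((2 : ℝ) ^ (N * m)) * (ENNReal.ofReal ((2 : ℝ) ^ ((l : ℝ) * t)) *
        (ENNReal.ofReal ((2 : ℝ) ^ ((n : ℝ) * s)) * eLpNorm (leafOp χ n Γ f) p (leafMeasure Γ))) := by
          ring
      _ ≤ _ := by gcongr
  have hkq : eLpNorm (fun z => k (z₀ - z)) q volume ≤ ENNReal.ofReal (H * 2 ^ (N * ds)) * W := by
    have h1 : eLpNorm (fun z => k (z₀ - z)) q volume = eLpNorm k q volume :=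
      eLpNorm_comp_measurePreserving hkc.aestronglyMeasurable
        (Measure.measurePreserving_sub_left volume z₀)
    rw [h1]
    refine eLpNorm_le_mul_eLpNorm_of_ae_le_mul (Filter.Eventually.of_forall fun v => ?_) q
    rw [Real.norm_of_nonneg (by unfold weight; positivity)]
    exact hk N v
  have hkc' : Continuous fun z => k (z₀ - z) := hkc.comp (by fun_prop)
  have hkL : MemLp (fun z => k (z₀ - z)) q volume := ⟨hkc'.aestronglyMeasurable,
    hkq.trans_lt (ENNReal.mul_lt_top ENNReal.ofReal_lt_top hW)⟩
  have hFL : ∀ n ∈ Finset.range (N + 1), MemLp (F n) p volume := fun n hn =>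
    ⟨(hFc n).aestronglyMeasurable,
      (hFn n hn).trans_lt (ENNReal.mul_lt_top ENNReal.ofReal_lt_top hUt)⟩
  -- Second use of the reproducing formula: integration against `k` turns the `L_p` bounds on the
  -- pieces into a bound at the single point `y`, by Hölder's inequality.
  have hval : f y = ∑ n ∈ Finset.range (N + 1), ∫ z, k (z₀ - z) * F n z := by
    have hI : ∀ n ∈ Finset.range (N + 1), Integrable (fun z => k (z₀ - z) * F n z) :=
      fun n hn => hkL.integrable_mul (hFL n hn)
    rw [← integral_finsetSum _ hI, ← hy, ← hrep z₀]
    refine integral_congr_ae (Filter.Eventually.of_forall fun z => ?_)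
    simp only
    rw [hsum z, Finset.mul_sum]
  have hterm : ∀ n ∈ Finset.range (N + 1), ‖∫ z, k (z₀ - z) * F n z‖ₑ ≤
      (ENNReal.ofReal (H * 2 ^ (N * ds)) * W) * (ENNReal.ofReal ((2 : ℝ) ^ (N * m)) * U) := by
    intro n hn
    refine (enorm_integral_le_lintegral_enorm _).trans ?_
    rw [← eLpNorm_one_eq_lintegral_enorm]
    refine (eLpNorm_smul_le_mul_eLpNorm (p := q) (q := p) (r := 1) (hFc n).aestronglyMeasurable
      hkc'.aestronglyMeasurable).trans ?_
    gcongr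
    exact hFn n hn
  have hterm' : ∀ n ∈ Finset.range (N + 1), ‖∫ z, k (z₀ - z) * F n z‖ ≤
      (H * 2 ^ (N * ds) * W.toReal) * (2 ^ (N * m) * U.toReal) := by
    intro n hn
    have := ENNReal.toReal_mono (ENNReal.mul_ne_top (ENNReal.mul_ne_top ENNReal.ofReal_ne_top hW.ne)
      (ENNReal.mul_ne_top ENNReal.ofReal_ne_top hUt.ne)) (hterm n hn)
    rwa [toReal_enorm, ENNReal.toReal_mul, ENNReal.toReal_mul, ENNReal.toReal_mul,
      ENNReal.toReal_ofReal (by positivity), ENNReal.toReal_ofReal (by positivity)] at this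
  rw [hval]
  refine (norm_sum_le_of_le _ hterm').trans ?_
  rw [Finset.sum_const, Finset.card_range, nsmul_eq_mul]
  have hN2 : ((N + 1 : ℕ) : ℝ) ≤ 2 ^ N := by exact_mod_cast Nat.lt_two_pow_self
  have hpow : (2 : ℝ) ^ N * 2 ^ (N * ds) * 2 ^ (N * m) = (2 ^ (c + 1)) ^ b * (2 ^ l) ^ b := by
    rw [← mul_pow, ← pow_add, ← pow_add, ← pow_add, ← pow_mul, hb, hN]
    ring_nf
  calc _ ≤ (2 : ℝ) ^ N * ((H * 2 ^ (N * ds) * W.toReal) * (2 ^ (N * m) * U.toReal)) := by gcongr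
    _ = ((2 : ℝ) ^ N * 2 ^ (N * ds) * 2 ^ (N * m)) * (H * W.toReal * U.toReal) := by ring
    _ = _ := by rw [hpow]; ring

end SupBound

/-! ### Smooth atoms attached to lattice points -/

section Atoms

theorem norm_iteratedFDeriv_comp_smul_sub_le {V : Type*} [NormedAddCommGroup V] [NormedSpace ℝ V]
    (κ : 𝓢(V, ℂ)) {c : ℝ} (hc : 0 ≤ c) (a : V) (i : ℕ) (x : V) :
    ‖iteratedFDeriv ℝ i (fun x => κ (c • x - a)) x‖ ≤ c ^ i * ‖iteratedFDeriv ℝ i κ (c • x - a)‖ := by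
  set g : V →L[ℝ] V := c • ContinuousLinearMap.id ℝ V
  have hs : ContDiff ℝ i (fun z => κ (z - a)) := (κ.smooth i).comp (by fun_prop)
  have h := g.iteratedFDeriv_comp_right hs x (i := i) le_rfl
  have e : (fun z => κ (z - a)) ∘ g = fun x => κ (c • x - a) := rfl
  rw [e, iteratedFDeriv_comp_sub] at h
  rw [h]
  refine (ContinuousMultilinearMap.norm_compContinuousLinearMap_le _ _).trans ?_
  rw [Finset.prod_const, Finset.card_univ, Fintype.card_fin, mul_comm]
  have hg : ‖g‖ ≤ c := by
    refine g.opNorm_le_bound hc fun x => ?_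
    change ‖c • x‖ ≤ c * ‖x‖
    rw [norm_smul, Real.norm_of_nonneg hc]
  have hgx : g x = c • x := rfl
  rw [hgx]
  gcongr

variable {ι : Type*} [Fintype ι]

/-- The vectors `latticePt k` lie in a lattice of rank `card ι`, over which inverse powers of the
norm of larger exponent are summable. -/
theorem summable_latticePt :
    Summable fun k : ι → ℤ => ((1 + ‖latticePt k‖) ^ (Fintype.card ι + 1))⁻¹ := by
  classical
  set L : Submodule ℤ (EuclideanSpace ℝ ι) :=
    Submodule.span ℤ (Set.range (EuclideanSpace.basisFun ι ℝ).toBasis)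
  have hmem : ∀ k : ι → ℤ, latticePt k ∈ L := by
    intro k
    have e : latticePt k = ∑ i, k i • (EuclideanSpace.basisFun ι ℝ).toBasis i := by
      ext j
      simp [latticePt, Finset.sum_apply, Pi.single_apply]
    rw [e]
    exact Submodule.sum_mem _ fun i _ => Submodule.smul_mem _ _ (Submodule.subset_span ⟨i, rfl⟩)
  have hinj : Function.Injective fun k : ι → ℤ => (⟨latticePt k, hmem k⟩ : L) := by
    intro k k' h
    have h' : latticePt k = latticePt k' := congrArg Subtype.val h
    funext i
    have : (latticePt k) i = (latticePt k') i := by rw [h']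
    simpa [latticePt] using this
  have hrank : Module.finrank ℤ L < Fintype.card ι + 1 := by
    have := ZLattice.rank ℝ L
    rw [this]
    simp
  have hs := (ZLattice.summable_norm_pow_inv L _ hrank).comp_injective hinj
  have h0 : ∀ᶠ k : ι → ℤ in Filter.cofinite, k ≠ 0 := by simp
  refine Summable.of_norm_bounded_eventually hs ?_
  filter_upwards [h0] with k hk
  have hk0 : 0 < ‖latticePt k‖ := by
    rw [norm_pos_iff]
    intro h
    refine hk (hinj (Subtype.ext ?_))
    change latticePt k = latticePt 0
    rw [h]
    ext i
    simp [latticePt]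
  rw [Real.norm_of_nonneg (by positivity), Function.comp, inv_pow]
  change ((1 + ‖latticePt k‖) ^ (Fintype.card ι + 1))⁻¹ ≤ (‖latticePt k‖ ^ (Fintype.card ι + 1))⁻¹
  gcongr
  linarith

variable {K : Set (EuclideanSpace ℝ ι)}

/-- The function `x ↦ φ(x) κ(2^n x - k)`. -/
def atomFun (φ κ : 𝓢(EuclideanSpace ℝ ι, ℂ)) (n : ℕ) (k : ι → ℤ) (x : EuclideanSpace ℝ ι) : ℂ :=
  φ x * κ ((2 : ℝ) ^ n • x - latticePt k)

theorem contDiff_atomFun (φ κ : 𝓢(EuclideanSpace ℝ ι, ℂ)) (n : ℕ) (k : ι → ℤ) (N : ℕ∞) :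
    ContDiff ℝ N (atomFun φ κ n k) :=
  (φ.smooth N).mul ((κ.smooth N).comp (by fun_prop))

theorem iteratedFDeriv_eq_zero_of_notMem (hK : IsClosed K) {f : EuclideanSpace ℝ ι → ℂ}
    (hf : ∀ x ∉ K, f x = 0) (i : ℕ) {x : EuclideanSpace ℝ ι} (hx : x ∉ K) :
    iteratedFDeriv ℝ i f x = 0 := by
  by_contra h
  refine hx ?_
  have h1 : x ∈ tsupport f := support_iteratedFDeriv_subset i h
  exact closure_minimal (fun y hy => by_contra fun hyK => Function.mem_support.1 hy (hf y hyK)) hK h1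

/-- By the Leibniz rule each derivative falling on `κ(2^n x - k)` costs a factor `2^n`, while the
decay of `κ` around `k` survives differentiation. -/
theorem norm_iteratedFDeriv_atomFun_le (φ κ : 𝓢(EuclideanSpace ℝ ι, ℂ)) (N m : ℕ) :
    ∃ C : ℝ, 0 ≤ C ∧ ∀ (n : ℕ) (k : ι → ℤ), ∀ i ≤ N, ∀ x,
      ‖iteratedFDeriv ℝ i (atomFun φ κ n k) x‖ * (1 + ‖(2 : ℝ) ^ n • x - latticePt k‖) ^ m ≤
        C * (2 ^ n) ^ N := by
  set S : ℝ := ((Finset.Iic (0, N)).sup fun m => SchwartzMap.seminorm ℂ m.1 m.2) φ with hS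
  set Q : ℝ := 2 ^ m * ((Finset.Iic (m, N)).sup fun m => SchwartzMap.seminorm ℂ m.1 m.2) κ with hQ
  have hS0 : 0 ≤ S := apply_nonneg _ _
  have hQ0 : 0 ≤ Q := mul_nonneg (by positivity) (apply_nonneg _ _)
  have hφ : ∀ j ≤ N, ∀ x, ‖iteratedFDeriv ℝ j φ x‖ ≤ S := by
    intro j hj x
    have := SchwartzMap.one_add_le_sup_seminorm_apply (𝕜 := ℂ) (m := (0, N)) le_rfl hj φ x
    simpa using this
  have hκ : ∀ j ≤ N, ∀ y, ‖iteratedFDeriv ℝ j κ y‖ * (1 + ‖y‖) ^ m ≤ Q := by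
    intro j hj y
    rw [mul_comm]
    exact SchwartzMap.one_add_le_sup_seminorm_apply (𝕜 := ℂ) (m := (m, N)) le_rfl hj κ y
  refine ⟨2 ^ N * (S * Q), by positivity, fun n k i hi x => ?_⟩
  set y := (2 : ℝ) ^ n • x - latticePt k with hy
  have h1 : ‖iteratedFDeriv ℝ i (atomFun φ κ n k) x‖ ≤ _ :=
    norm_iteratedFDeriv_mul_le (N := (i : ℕ∞)) (φ.smooth i)
      (g := fun x => κ ((2 : ℝ) ^ n • x - latticePt k)) ((κ.smooth i).comp (by fun_prop)) x
      (n := i) le_rfl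
  have h2 : ∀ j ∈ Finset.range (i + 1),
      (i.choose j : ℝ) * ‖iteratedFDeriv ℝ j φ x‖ *
        ‖iteratedFDeriv ℝ (i - j) (fun x => κ ((2 : ℝ) ^ n • x - latticePt k)) x‖ *
          (1 + ‖y‖) ^ m ≤ (i.choose j : ℝ) * (S * Q * (2 ^ n) ^ N) := by
    intro j hj
    have hji : j ≤ i := Nat.lt_succ_iff.1 (Finset.mem_range.1 hj)
    have h3 := norm_iteratedFDeriv_comp_smul_sub_le κ (c := 2 ^ n) (by positivity) (latticePt k)
      (i - j) x
    have h4 := hκ (i - j) ((Nat.sub_le _ _).trans hi) y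
    have h5 : ((2 : ℝ) ^ n) ^ (i - j) ≤ (2 ^ n) ^ N :=
      pow_le_pow_right₀ (one_le_pow₀ one_le_two) ((Nat.sub_le _ _).trans hi)
    calc _ ≤ (i.choose j : ℝ) * S * (((2 : ℝ) ^ n) ^ (i - j) * ‖iteratedFDeriv ℝ (i - j) κ y‖) *
          (1 + ‖y‖) ^ m := by
          gcongr
          exact hφ j (hji.trans hi) x
      _ = (i.choose j : ℝ) * (S * (‖iteratedFDeriv ℝ (i - j) κ y‖ * (1 + ‖y‖) ^ m) *
          ((2 : ℝ) ^ n) ^ (i - j)) := by ring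
      _ ≤ _ := by gcongr
  calc _ ≤ (∑ j ∈ Finset.range (i + 1), (i.choose j : ℝ) * ‖iteratedFDeriv ℝ j φ x‖ *
        ‖iteratedFDeriv ℝ (i - j) (fun x => κ ((2 : ℝ) ^ n • x - latticePt k)) x‖) *
          (1 + ‖y‖) ^ m := by gcongr
    _ ≤ ∑ j ∈ Finset.range (i + 1), (i.choose j : ℝ) * (S * Q * (2 ^ n) ^ N) := by
        rw [Finset.sum_mul]
        exact Finset.sum_le_sum h2
    _ = 2 ^ i * (S * Q * (2 ^ n) ^ N) := by
        rw [← Finset.sum_mul]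
        congr 1
        exact_mod_cast Nat.sum_range_choose i
    _ ≤ 2 ^ N * (S * Q * (2 ^ n) ^ N) := by
        gcongr
        exact one_le_two
    _ = _ := by ring

/-- A series of atoms whose lattice points are far from `2^n K` is small. -/
theorem exists_schwartzNorm_tsum_atomFun_le (hK : IsCompact K) (φ κ : 𝓢(EuclideanSpace ℝ ι, ℂ))
    (hφ : ∀ x ∉ K, φ x = 0) (N : ℕ) :
    ∃ b : ℕ, ∀ m : ℕ, ∃ C : ℝ, 0 ≤ C ∧ ∀ (n : ℕ) (a : (ι → ℤ) → ℂ) (α δ : ℝ), 0 ≤ α → 0 < δ →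
      (∀ k, ‖a k‖ ≤ α) →
      (∀ k, ∀ x ∈ K, a k ≠ 0 → δ ≤ 1 + ‖(2 : ℝ) ^ n • x - latticePt k‖) →
      ∀ f : 𝓢(EuclideanSpace ℝ ι, ℂ), (∀ x, f x = ∑' k, a k * atomFun φ κ n k x) →
        schwartzNorm N f ≤ C * (2 ^ n) ^ b * (δ ^ m)⁻¹ * α := by
  set d := Fintype.card ι + 1 with hd
  obtain ⟨R, hR0, hR⟩ : ∃ R : ℝ, 0 ≤ R ∧ ∀ x ∈ K, ‖x‖ ≤ R := by
    obtain ⟨R, hR⟩ := hK.isBounded.exists_norm_le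
    exact ⟨max R 0, le_max_right _ _, fun x hx => (hR x hx).trans (le_max_left _ _)⟩
  -- `N` powers of `2^n` come from the derivatives and `d` from summing over `k`. The exponent is
  -- fixed before `m`, which is what lets the decay win later.
  refine ⟨N + d, fun m => ?_⟩
  obtain ⟨C, hC0, hC⟩ := norm_iteratedFDeriv_atomFun_le φ κ N (m + d)
  set w : (ι → ℤ) → ℝ := fun k => ((1 + ‖latticePt k‖) ^ d)⁻¹ with hw
  have hws : Summable w := summable_latticePt
  have hw0 : 0 ≤ ∑' k, w k := tsum_nonneg fun k => by positivity
  refine ⟨(1 + R) ^ N * (C * (1 + R) ^ d * ∑' k, w k), by positivity,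
    fun n a α δ hα hδ ha hfar f hf => ?_⟩
  have hatom0 : ∀ k, ∀ x ∉ K, atomFun φ κ n k x = 0 := fun k x hx => by
    rw [atomFun, hφ x hx, zero_mul]
  set M : ℝ := C * (2 ^ n) ^ (N + d) * (1 + R) ^ d * (δ ^ m)⁻¹ * α with hM
  have hM0 : 0 ≤ M := by positivity
  have hbound : ∀ i ≤ N, ∀ k x,
      ‖iteratedFDeriv ℝ i (fun x => a k * atomFun φ κ n k x) x‖ ≤ M * w k := by
    intro i hi k x
    have e : (fun x => a k * atomFun φ κ n k x) = a k • atomFun φ κ n k := rfl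
    rw [e, iteratedFDeriv_const_smul_apply (contDiff_atomFun φ κ n k i).contDiffAt, norm_smul]
    by_cases hak : a k = 0
    · rw [hak, norm_zero, zero_mul]
      positivity
    by_cases hx : x ∈ K
    · set y := (2 : ℝ) ^ n • x - latticePt k with hy
      have h1 := hC n k i hi x
      have h2 := hfar k x hx hak
      have h2n : (1 : ℝ) ≤ 2 ^ n := one_le_pow₀ one_le_two
      -- For `x ∈ K`, decay in `2^n x - k` is traded for decay in `k`: of the `m + d` available
      -- powers, `d` make the series summable and `m` give `δ^{-m}`.
      have h3 : 1 + ‖latticePt k‖ ≤ (1 + ‖y‖) * (2 ^ n * (1 + R)) := by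
        have e1 : latticePt k = (2 : ℝ) ^ n • x - y := by rw [hy]; abel
        have e2 : ‖latticePt k‖ ≤ 2 ^ n * R + ‖y‖ := by
          rw [e1]
          refine (norm_sub_le _ _).trans ?_
          rw [norm_smul, Real.norm_of_nonneg (by positivity)]
          gcongr
          exact hR x hx
        nlinarith [norm_nonneg y, mul_nonneg (norm_nonneg y) hR0,
          mul_nonneg (norm_nonneg y) (sub_nonneg.2 h2n),
          mul_nonneg (mul_nonneg (norm_nonneg y) hR0) (sub_nonneg.2 h2n)]
      have h4 : δ ^ m * (1 + ‖latticePt k‖) ^ d ≤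
          (1 + ‖y‖) ^ (m + d) * (2 ^ n * (1 + R)) ^ d := by
        calc _ ≤ (1 + ‖y‖) ^ m * ((1 + ‖y‖) * (2 ^ n * (1 + R))) ^ d := by gcongr
          _ = _ := by rw [mul_pow, pow_add]; ring
      have h5 : ‖iteratedFDeriv ℝ i (atomFun φ κ n k) x‖ * (δ ^ m * (1 + ‖latticePt k‖) ^ d) ≤
          C * (2 ^ n) ^ (N + d) * (1 + R) ^ d := by
        calc _ ≤ ‖iteratedFDeriv ℝ i (atomFun φ κ n k) x‖ *
              ((1 + ‖y‖) ^ (m + d) * (2 ^ n * (1 + R)) ^ d) := by gcongr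
          _ = (‖iteratedFDeriv ℝ i (atomFun φ κ n k) x‖ * (1 + ‖y‖) ^ (m + d)) *
              (2 ^ n * (1 + R)) ^ d := by ring
          _ ≤ (C * (2 ^ n) ^ N) * (2 ^ n * (1 + R)) ^ d := by gcongr
          _ = _ := by rw [mul_pow, pow_add]; ring
      have h6 : ‖iteratedFDeriv ℝ i (atomFun φ κ n k) x‖ ≤
          C * (2 ^ n) ^ (N + d) * (1 + R) ^ d * ((δ ^ m)⁻¹ * w k) := by
        rw [hw, ← mul_inv, ← div_eq_mul_inv, le_div_iff₀ (by positivity)]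
        exact h5
      calc _ ≤ α * (C * (2 ^ n) ^ (N + d) * (1 + R) ^ d * ((δ ^ m)⁻¹ * w k)) := by
            gcongr
            exact ha k
        _ = _ := by rw [hM]; ring
    · rw [iteratedFDeriv_eq_zero_of_notMem hK.isClosed (hatom0 k) i hx, norm_zero, mul_zero]
      positivity
  have hfe : (f : EuclideanSpace ℝ ι → ℂ) = fun x => ∑' k, a k * atomFun φ κ n k x := funext hf
  have hfK : ∀ x ∉ K, f x = 0 := by
    intro x hx
    rw [hf]
    simp only [hatom0 _ x hx, mul_zero, tsum_zero]
  refine schwartzNorm_le N f (by positivity) fun j hj i hi x => ?_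
  by_cases hx : x ∈ K
  · have h1 : iteratedFDeriv ℝ i f x =
        ∑' k, iteratedFDeriv ℝ i (fun x => a k * atomFun φ κ n k x) x := by
      rw [hfe]
      refine iteratedFDeriv_tsum_apply (N := (N : ℕ∞)) (v := fun _ k => M * w k)
        (fun k => contDiff_const.mul (contDiff_atomFun φ κ n k N))
        (fun _ _ => hws.mul_left M) (fun i k x hi => hbound i (by exact_mod_cast hi) k x)
        (by exact_mod_cast hi) x
    have h2 : ‖iteratedFDeriv ℝ i f x‖ ≤ M * ∑' k, w k := by
      rw [h1, ← tsum_mul_left]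
      exact tsum_of_norm_bounded (hws.mul_left M).hasSum fun k => hbound i hi k x
    have h3 : ‖x‖ ^ j ≤ (1 + R) ^ N := by
      calc ‖x‖ ^ j ≤ (1 + R) ^ j := by
            gcongr
            linarith [hR x hx]
        _ ≤ (1 + R) ^ N := pow_le_pow_right₀ (by linarith) hj
    calc _ ≤ (1 + R) ^ N * (M * ∑' k, w k) := by gcongr
      _ = _ := by rw [hM]; ring
  · rw [iteratedFDeriv_eq_zero_of_notMem hK.isClosed hfK i hx, norm_zero, mul_zero]
    positivity

end Atoms

/-! ### Sampling of the Littlewood-Paley pieces -/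

section Approximation

open FourierTransform in
-- For `l ≤ n` the spectrum of `ψ_l^{Op} u` in the variable `ζ = ξ / 2π`, rescaled by `2^n`, lies in
-- the ball of radius `1/π`. The kernel is the inverse transform of a bump equal to `1` on this ball
-- and `0` outside the ball of radius `1/2`, so one `κ` serves all scales.
theorem exists_sampling_kernel (χ : Cutoff) {ι : Type*} [Fintype ι] :
    ∃ κ : 𝓢(EuclideanSpace ℝ ι, ℂ), ∀ (l n : ℕ), l ≤ n → ∀ (u : 𝓢(EuclideanSpace ℝ ι, ℂ)) x,
      HasSum (fun k : ι → ℤ => lpOp χ l u (((2 : ℝ) ^ n)⁻¹ • latticePt k) *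
        κ ((2 : ℝ) ^ n • x - latticePt k)) (lpOp χ l u x) := by
  have hπ : 1 / Real.pi < 1 / 2 :=
    one_div_lt_one_div_of_lt two_pos (by linarith [Real.pi_gt_three])
  let β : ContDiffBump (0 : EuclideanSpace ℝ ι) := ⟨1 / Real.pi, 1 / 2, by positivity, hπ⟩
  set η : EuclideanSpace ℝ ι → ℂ := fun w => ((β w : ℝ) : ℂ) with hη
  have hηs : ContDiff ℝ ∞ η := Complex.ofRealCLM.contDiff.comp β.contDiff
  have hηc : HasCompactSupport η :=
    β.hasCompactSupport.comp_left (g := fun x : ℝ => (x : ℂ)) (by simp)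
  refine ⟨𝓕⁻ (hηc.toSchwartzMap hηs), fun l n hln u x => ?_⟩
  have hκ : ((𝓕⁻ (hηc.toSchwartzMap hηs) : 𝓢(EuclideanSpace ℝ ι, ℂ)) : EuclideanSpace ℝ ι → ℂ) =
      𝓕⁻ η := by
    rw [SchwartzMap.fourierInv_coe]
    rfl
  set g := lpOp χ l u with hg
  set G : 𝓢(EuclideanSpace ℝ ι, ℂ) := 𝓕 g with hG
  have hc : (0 : ℝ) < 2 ^ n := by positivity
  -- The spectrum of `y ↦ g(2^{-n} y)`, with its Jacobian, so that the samples fall on the integer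
  -- lattice.
  set F : EuclideanSpace ℝ ι → ℂ := fun w =>
    ((((2 : ℝ) ^ n) ^ Module.finrank ℝ (EuclideanSpace ℝ ι) : ℝ) : ℂ) * G ((2 : ℝ) ^ n • w) with hF
  have hFc : Continuous F := by
    have := G.continuous
    simp only [hF]
    fun_prop
  have hF0 : ∀ w, 1 / Real.pi ≤ ‖w‖ → F w = 0 := by
    intro w hw
    have h1 : (2 : ℝ) ^ (l + 1) ≤ ‖(2 * Real.pi) • (2 : ℝ) ^ n • w‖ := by
      rw [norm_smul, norm_smul, Real.norm_of_nonneg (by positivity),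
        Real.norm_of_nonneg (by positivity)]
      have h2 : (2 : ℝ) ^ l ≤ 2 ^ n := pow_le_pow_right₀ one_le_two hln
      rw [div_le_iff₀ Real.pi_pos] at hw
      calc (2 : ℝ) ^ (l + 1) = 2 * 2 ^ l * 1 := by ring
        _ ≤ 2 * 2 ^ n * (‖w‖ * Real.pi) := by gcongr
        _ = _ := by ring
    simp only [hF, hG, hg]
    rw [fourier_lpOp, lpSymbol_eq_zero χ h1]
    simp
  have hFinv : ∀ y, 𝓕⁻ F y = g (((2 : ℝ) ^ n)⁻¹ • y) := by
    intro y
    have h1 : g (((2 : ℝ) ^ n)⁻¹ • y) = (𝓕⁻ G : 𝓢(EuclideanSpace ℝ ι, ℂ)) (((2 : ℝ) ^ n)⁻¹ • y) := by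
      rw [hG, FourierTransform.fourierInv_fourier_eq]
    rw [h1, SchwartzMap.fourierInv_coe, Real.fourierInv_eq', Real.fourierInv_eq']
    have h2 := Measure.integral_comp_smul (volume : Measure (EuclideanSpace ℝ ι))
      (fun ζ => Complex.exp (((2 * Real.pi * inner ℝ ζ (((2 : ℝ) ^ n)⁻¹ • y) : ℝ) : ℂ) *
        Complex.I) • G ζ) ((2 : ℝ) ^ n)
    rw [abs_of_pos (by positivity), Complex.real_smul, Complex.ofReal_inv] at h2
    have hne : ((((2 : ℝ) ^ n) ^ Module.finrank ℝ (EuclideanSpace ℝ ι) : ℝ) : ℂ) ≠ 0 := by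
      exact_mod_cast (pow_pos hc _).ne'
    rw [eq_inv_mul_iff_mul_eq₀ hne] at h2
    rw [← h2, ← integral_const_mul]
    refine integral_congr_ae (Filter.Eventually.of_forall fun w => ?_)
    simp only [hF, smul_eq_mul, real_inner_smul_left, real_inner_smul_right]
    rw [inv_mul_cancel_left₀ hc.ne']
    ring
  have h := hasSum_sampling hFc hηs.continuous hF0 hπ.le
    (fun w hw => by
      simp only [hη]
      rw [β.one_of_mem_closedBall (by simpa [β] using hw), Complex.ofReal_one])
    (fun w hw => by
      simp only [hη]
      rw [β.zero_of_le_dist (by simpa [β] using hw), Complex.ofReal_zero]) ((2 : ℝ) ^ n • x)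
  simp only [hFinv] at h
  rw [smul_smul, inv_mul_cancel₀ hc.ne', one_smul] at h
  rw [hκ]
  exact h

variable {ds du : ℕ} {K : Set (Ambient ds du)}

/-- The value at `z` of the sum of the first Littlewood-Paley pieces. -/
def lowValue (χ : Cutoff) (K : Set (Ambient ds du)) (n : ℕ) (z : Ambient ds du) :
    smoothIn K →ₗ[ℂ] ℂ where
  toFun u := ∑ l ∈ Finset.range (n + 1), lpOp χ l (u : 𝓢(Ambient ds du, ℂ)) z
  map_add' u v := by simp [Finset.sum_add_distrib]
  map_smul' c u := by simp [Finset.mul_sum]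

/-- Point evaluations of the truncated sum are continuous for the anisotropic norm and extend to the
completion; they are the coefficient functionals of the finite rank operator. The sum of `n + 1 ≤
2^n` terms accounts for one more power. -/
theorem exists_norm_lowValue_le (χ : Cutoff) {r : ℝ} (hr : 1 < r) {C : ConePair ds du}
    (hC : C.HorizontalSubset) {CF : ℝ} (hCF : 1 ≤ CF) (p : ℝ≥0∞) [hp : Fact (1 ≤ p)] {t s : ℝ}
    (ht : 0 ≤ t) (hs : s ≤ 0) (K : Set (Ambient ds du)) :
    ∃ (b : ℕ) (D : ℝ), 0 ≤ D ∧ ∀ (n : ℕ) (z : Ambient ds du) (u : smoothIn K),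
      ‖lowValue χ K n z u‖ ≤ D * (2 ^ n) ^ b * ‖toU χ r hC CF p t hs K u‖ := by
  obtain ⟨b, D, hD, h⟩ := exists_norm_lpOp_le χ hr hC hCF hp.out ht hs
  refine ⟨b + 1, D, hD, fun n z u => ?_⟩
  rw [norm_toU]
  set U := (uENorm χ r C CF p t s (u : 𝓢(Ambient ds du, ℂ))).toReal
  have hU : 0 ≤ U := ENNReal.toReal_nonneg
  have h1 : ∀ l ∈ Finset.range (n + 1), ‖lpOp χ l (u : 𝓢(Ambient ds du, ℂ)) z‖ ≤
      D * (2 ^ n) ^ b * U := by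
    intro l hl
    refine (h _ l z).trans ?_
    have : (2 : ℝ) ^ l ≤ 2 ^ n :=
      pow_le_pow_right₀ one_le_two (Nat.lt_succ_iff.1 (Finset.mem_range.1 hl))
    gcongr
  refine (norm_sum_le_of_le _ h1).trans ?_
  rw [Finset.sum_const, Finset.card_range, nsmul_eq_mul]
  have hn : ((n + 1 : ℕ) : ℝ) ≤ 2 ^ n := by exact_mod_cast Nat.lt_two_pow_self
  calc _ ≤ (2 : ℝ) ^ n * (D * (2 ^ n) ^ b * U) := by gcongr
    _ = _ := by ring

/-- The function `x ↦ φ(x) κ(2^n x - k)`, as an element of `C^∞(K)`. -/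
def atom (hK : IsCompact K) (φ : smoothIn K) (κ : 𝓢(Ambient ds du, ℂ)) (n : ℕ)
    (k : Fin ds ⊕ Fin du → ℤ) : smoothIn K :=
  ⟨HasCompactSupport.toSchwartzMap (f := atomFun φ.1 κ n k)
    (HasCompactSupport.intro hK fun x hx => by rw [atomFun, φ.2 x hx, zero_mul])
    (contDiff_atomFun φ.1 κ n k ⊤), fun x hx => by
      change atomFun φ.1 κ n k x = 0
      rw [atomFun, φ.2 x hx, zero_mul]⟩

theorem atom_apply (hK : IsCompact K) (φ : smoothIn K) (κ : 𝓢(Ambient ds du, ℂ)) (n : ℕ)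
    (k : Fin ds ⊕ Fin du → ℤ) (x : Ambient ds du) :
    (atom hK φ κ n k).1 x = atomFun φ.1 κ n k x := rfl

/-- Finite sums of atoms approximate the truncated operators. -/
theorem exists_norm_truncOp_sub_le (χ : Cutoff) {r : ℝ} (hr : 1 < r) {C C' : ConePair ds du}
    (hC : C.HorizontalSubset) (hC' : C'.HorizontalSubset) {CF : ℝ} (hCF : 1 ≤ CF) (CF' : ℝ)
    (p : ℝ≥0∞) [hp : Fact (1 ≤ p)] {t s : ℝ} (ht : 0 ≤ t) (hs : s ≤ 0) (hK : IsCompact K)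
    (φ : smoothIn K) :
    ∃ (κ : 𝓢(Ambient ds du, ℂ)) (b : ℕ), ∀ m : ℕ, ∃ D : ℝ, 0 ≤ D ∧
      ∀ (n₀ n₁ : ℕ), n₀ ≤ n₁ → ∀ (A : Finset (Fin ds ⊕ Fin du → ℤ)) (δ : ℝ), 0 < δ →
        (∀ k ∉ A, ∀ x ∈ K, δ ≤ 1 + ‖(2 : ℝ) ^ n₁ • x - latticePt k‖) → ∀ u : smoothIn K,
        ‖toU χ r hC' CF' p t hs K (truncOp χ φ n₀ u) -
          ∑ k ∈ A, lowValue χ K n₀ (((2 : ℝ) ^ n₁)⁻¹ • latticePt k) u •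
            toU χ r hC' CF' p t hs K (atom hK φ κ n₁ k)‖ ≤
          D * (2 ^ n₁) ^ b * (δ ^ m)⁻¹ * ‖toU χ r hC CF p t hs K u‖ := by
  classical
  obtain ⟨κ, hκ⟩ := exists_sampling_kernel χ (ι := Fin ds ⊕ Fin du)
  obtain ⟨N, D₁, hD₁, h₁⟩ := uENorm_le_schwartzNorm χ r hC' CF' hp.out t hs
  obtain ⟨b₂, D₂, hD₂, h₂⟩ := exists_norm_lowValue_le χ hr hC hCF p ht hs K
  obtain ⟨b₃, h₃⟩ := exists_schwartzNorm_tsum_atomFun_le hK φ.1 κ φ.2 N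
  refine ⟨κ, b₃ + b₂, fun m => ?_⟩
  obtain ⟨D₃, hD₃, h₃⟩ := h₃ m
  refine ⟨D₁ * D₃ * D₂, by positivity, fun n₀ n₁ hn A δ hδ hA u => ?_⟩
  set a : (Fin ds ⊕ Fin du → ℤ) → ℂ := fun k =>
    lowValue χ K n₀ (((2 : ℝ) ^ n₁)⁻¹ • latticePt k) u with ha
  -- The error is itself an atomic series, with the coefficients on `A` replaced by `0`, so the tail
  -- estimate applies to it.
  set f : smoothIn K := truncOp χ φ n₀ u - ∑ k ∈ A, a k • atom hK φ κ n₁ k with hf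
  have hsum : ∀ x, HasSum (fun k => a k * atomFun φ.1 κ n₁ k x) ((truncOp χ φ n₀ u).1 x) := by
    intro x
    have h := (hasSum_sum (s := Finset.range (n₀ + 1)) fun l hl =>
      hκ l n₁ ((Nat.lt_succ_iff.1 (Finset.mem_range.1 hl)).trans hn) u.1 x).mul_left (φ.1 x)
    rw [truncOp_apply]
    refine h.congr_fun fun k => ?_
    rw [← Finset.sum_mul]
    simp only [ha, atomFun, lowValue, LinearMap.coe_mk, AddHom.coe_mk]
    ring
  have hfx : ∀ x, f.1 x = ∑' k, (if k ∈ A then 0 else a k) * atomFun φ.1 κ n₁ k x := by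
    intro x
    have h4 : HasSum (fun k => if k ∈ A then a k * atomFun φ.1 κ n₁ k x else 0)
        (∑ k ∈ A, a k * atomFun φ.1 κ n₁ k x) := by
      rw [← Finset.sum_congr rfl fun k (hk : k ∈ A) => if_pos (t := a k * atomFun φ.1 κ n₁ k x)
        (e := (0 : ℂ)) hk]
      exact hasSum_sum_of_ne_finset_zero fun k hk => if_neg hk
    have h5 := (hsum x).sub h4
    have h6 : f.1 x = (truncOp χ φ n₀ u).1 x - ∑ k ∈ A, a k * atomFun φ.1 κ n₁ k x := by
      simp only [hf, Submodule.coe_sub, Submodule.coe_sum, Submodule.coe_smul,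
        sub_apply, sum_apply, smul_apply, smul_eq_mul, atom_apply]
    rw [h6, ← h5.tsum_eq]
    refine tsum_congr fun k => ?_
    split_ifs <;> simp
  have hα : 0 ≤ D₂ * (2 ^ n₀) ^ b₂ * ‖toU χ r hC CF p t hs K u‖ := by positivity
  have h7 := h₃ n₁ (fun k => if k ∈ A then 0 else a k) _ δ hα hδ
    (fun k => by
      split_ifs
      · rwa [norm_zero]
      · exact h₂ n₀ _ u)
    (fun k x hx hk => hA k (fun hkA => hk (by simp [hkA])) x hx) f.1 hfx
  have h8 : toU χ r hC' CF' p t hs K (truncOp χ φ n₀ u) -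
      ∑ k ∈ A, a k • toU χ r hC' CF' p t hs K (atom hK φ κ n₁ k) = toU χ r hC' CF' p t hs K f := by
    rw [hf, map_sub, map_sum]
    simp only [map_smul]
  rw [h8, norm_toU]
  have hn' : (2 : ℝ) ^ n₀ ≤ 2 ^ n₁ := pow_le_pow_right₀ one_le_two hn
  calc _ ≤ D₁ * (D₃ * (2 ^ n₁) ^ b₃ * (δ ^ m)⁻¹ *
        (D₂ * (2 ^ n₀) ^ b₂ * ‖toU χ r hC CF p t hs K u‖)) := (h₁ f.1).trans (by gcongr)
    _ ≤ D₁ * (D₃ * (2 ^ n₁) ^ b₃ * (δ ^ m)⁻¹ *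
        (D₂ * (2 ^ n₁) ^ b₂ * ‖toU χ r hC CF p t hs K u‖)) := by gcongr
    _ = _ := by rw [pow_add]; ring

/-- The lattice points close to `2^n K` are not too many. -/
theorem exists_finset_lattice (hK : IsCompact K) (n : ℕ) :
    ∃ A : Finset (Fin ds ⊕ Fin du → ℤ),
      (A.card : ℝ) ≤ (max 1 (Metric.diam K / 16)) ^ (ds + du) * 2 ^ ((ds + du) * (n + 5)) ∧
      ∀ k ∉ A, ∀ x ∈ K, (2 : ℝ) ^ n ≤ 1 + ‖(2 : ℝ) ^ n • x - latticePt k‖ := by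
  set D := Metric.diam K with hD
  have hD0 : 0 ≤ D := Metric.diam_nonneg
  -- `K` lies in a box of side `diam K` with lower corner `c`.
  obtain ⟨c, hc⟩ : ∃ c : Fin ds ⊕ Fin du → ℝ, ∀ x ∈ K, ∀ i, c i ≤ x i ∧ x i ≤ c i + D := by
    rcases K.eq_empty_or_nonempty with rfl | hne
    · exact ⟨0, fun x hx => absurd hx (Set.notMem_empty x)⟩
    refine ⟨fun i => sInf ((fun x : Ambient ds du => x i) '' K), fun x hx i => ?_⟩
    have hdist : ∀ y ∈ K, x i - D ≤ y i := by
      intro y hy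
      have h1 : |x i - y i| ≤ ‖x - y‖ := PiLp.norm_apply_le (x - y) i
      have h2 : dist x y ≤ D := Metric.dist_le_diam_of_mem hK.isBounded hx hy
      rw [dist_eq_norm] at h2
      linarith [le_abs_self (x i - y i)]
    refine ⟨csInf_le (hK.image (by fun_prop)).bddBelow ⟨x, hx, rfl⟩, ?_⟩
    have : x i - D ≤ sInf ((fun x : Ambient ds du => x i) '' K) := by
      refine le_csInf (hne.image _) ?_
      rintro _ ⟨y, hy, rfl⟩
      exact hdist y hy
    linarith
  have h2n : (1 : ℝ) ≤ 2 ^ n := one_le_pow₀ one_le_two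
  -- The box is enlarged by `1` on every side before scaling by `2^n`, so that a lattice point
  -- outside is at distance at least `2^n` from `2^n K`.
  refine ⟨Fintype.piFinset fun i =>
    Finset.Icc ⌈(2 : ℝ) ^ n * (c i - 1)⌉ ⌊(2 : ℝ) ^ n * (c i + D + 1)⌋, ?_, fun k hk x hx => ?_⟩
  · rw [Fintype.card_piFinset, Nat.cast_prod]
    have hi : ∀ i : Fin ds ⊕ Fin du, ((Finset.Icc ⌈(2 : ℝ) ^ n * (c i - 1)⌉
        ⌊(2 : ℝ) ^ n * (c i + D + 1)⌋).card : ℝ) ≤ max 1 (D / 16) * 2 ^ (n + 5) := by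
      intro i
      have h1 : (2 : ℝ) ^ n * (D + 2) + 1 ≤ max 1 (D / 16) * 2 ^ (n + 5) := by
        -- Source of the `5 = log₂ 32` in the rank: `D + 3 ≤ 32` if `D ≤ 16`, and `D + 3 ≤ 2 D`
        -- otherwise.
        have h2 : D + 3 ≤ max 1 (D / 16) * 32 := by
          rcases le_total 16 D with h | h
          · linarith [le_max_right 1 (D / 16)]
          · linarith [le_max_left 1 (D / 16)]
        calc (2 : ℝ) ^ n * (D + 2) + 1 ≤ 2 ^ n * (D + 3) := by linarith
          _ ≤ 2 ^ n * (max 1 (D / 16) * 32) := by gcongr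
          _ = _ := by ring
      refine le_trans ?_ h1
      rw [Int.card_Icc]
      have h3 := Int.floor_le ((2 : ℝ) ^ n * (c i + D + 1))
      have h4 := Int.le_ceil ((2 : ℝ) ^ n * (c i - 1))
      have h5 : (((⌊(2 : ℝ) ^ n * (c i + D + 1)⌋ + 1 - ⌈(2 : ℝ) ^ n * (c i - 1)⌉).toNat : ℤ) : ℝ) ≤
          2 ^ n * (D + 2) + 1 := by
        rw [Int.toNat_eq_max, Int.cast_max, max_le_iff]
        constructor
        · push_cast
          linarith
        · push_cast
          positivity
      exact_mod_cast h5
    refine (Finset.prod_le_prod (fun i _ => by positivity) fun i _ => hi i).trans (le_of_eq ?_)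
    rw [Finset.prod_const, Finset.card_univ, Fintype.card_sum, Fintype.card_fin, Fintype.card_fin,
      mul_pow, ← pow_mul, mul_comm (n + 5)]
  · rw [Fintype.mem_piFinset] at hk
    push Not at hk
    obtain ⟨i, hi⟩ := hk
    obtain ⟨hc1, hc2⟩ := hc x hx i
    have h1 : |(2 : ℝ) ^ n * x i - k i| ≤ ‖(2 : ℝ) ^ n • x - latticePt k‖ :=
      PiLp.norm_apply_le ((2 : ℝ) ^ n • x - latticePt k) i
    rw [Finset.mem_Icc, not_and_or, Int.ceil_le, Int.le_floor, not_le, not_le] at hi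
    rcases hi with hi | hi
    · have : (2 : ℝ) ^ n * (c i) ≤ 2 ^ n * x i := by gcongr
      linarith [le_abs_self ((2 : ℝ) ^ n * x i - k i)]
    · have : (2 : ℝ) ^ n * x i ≤ 2 ^ n * (c i + D) := by gcongr
      linarith [neg_abs_le ((2 : ℝ) ^ n * x i - k i)]

end Approximation

end AnisoU

end

/-! ### The finite rank approximation -/

theorem lemma3p7 {ds du : ℕ} (χ : AnisoU.Cutoff) (r : ℝ) (hr : 1 < r)
    (C C' : AnisoU.ConePair ds du) (hC : C.HorizontalSubset) (hC' : C'.HorizontalSubset)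
    (CF CF' : ℝ) (hCF : 1 ≤ CF) (hCF' : 1 ≤ CF')
    (p : ℝ≥0∞) [Fact (1 ≤ p)] (t s : ℝ) (hst : s ≤ -t) (ht : -t ≤ 0)
    (K : Set (AnisoU.Ambient ds du)) (hK : IsCompact K) (φ : AnisoU.smoothIn K) :
    -- the operators `𝓡_n` are bounded on the completions
    ∃ R : ℕ → (AnisoU.USpace χ r hC CF p t (hst.trans ht) K →L[ℂ]
        AnisoU.USpace χ r hC' CF' p t (hst.trans ht) K),
      (∀ (n : ℕ) (u : AnisoU.smoothIn K),
        R n (AnisoU.toU χ r hC CF p t (hst.trans ht) K u) =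
          AnisoU.toU χ r hC' CF' p t (hst.trans ht) K (AnisoU.truncOp χ φ n u)) ∧
      -- and they are approximated by operators of finite rank
      ∀ v : ℝ, 0 < v → ∃ Cv : ℝ, ∀ n₀ n₁ : ℕ, 1 ≤ n₀ → n₀ ≤ n₁ →
        ∃ T : AnisoU.USpace χ r hC CF p t (hst.trans ht) K →L[ℂ]
            AnisoU.USpace χ r hC' CF' p t (hst.trans ht) K,
          FiniteDimensional ℂ (LinearMap.range T.toLinearMap) ∧
          (Module.finrank ℂ (LinearMap.range T.toLinearMap) : ℝ) ≤
            (max 1 (Metric.diam K / 16)) ^ (ds + du) * 2 ^ ((ds + du) * (n₁ + 5)) ∧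
          ∀ u : AnisoU.USpace χ r hC CF p t (hst.trans ht) K,
            ‖R n₀ u - T u‖ ≤ Cv * (2 : ℝ) ^ (-(((ds + du : ℕ) : ℝ) * v * (n₁ : ℝ))) * ‖u‖ := by
  classical
  have hs : s ≤ 0 := hst.trans ht
  have ht0 : 0 ≤ t := by linarith
  obtain ⟨κ, b, hmain⟩ := AnisoU.exists_norm_truncOp_sub_le χ hr hC hC' hCF CF' p ht0 hs hK φ
  obtain ⟨b', D', hD', hval⟩ := AnisoU.exists_norm_lowValue_le χ hr hC hCF p ht0 hs K
  have hdense := AnisoU.denseRange_toU χ r hC CF p t hs K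
  -- With no atoms subtracted (`A = ∅`), `δ = 1` and `m = 0`, the approximation estimate is the
  -- boundedness of `𝓡_n`.
  obtain ⟨D₀, hD₀, hbdd⟩ := hmain 0
  have hR : ∀ n, ∃ M : ℝ, ∀ u, ‖(AnisoU.toU χ r hC' CF' p t hs K ∘ₗ AnisoU.truncOp χ φ n) u‖ ≤
      M * ‖AnisoU.toU χ r hC CF p t hs K u‖ := fun n => ⟨D₀ * (2 ^ n) ^ b, fun u => by
    have := hbdd n n le_rfl ∅ 1 one_pos (fun k _ x _ => by simp) u
    simpa using this⟩
  refine ⟨fun n => (AnisoU.toU χ r hC' CF' p t hs K ∘ₗ AnisoU.truncOp χ φ n).extendOfNorm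
    (AnisoU.toU χ r hC CF p t hs K), fun n u => LinearMap.extendOfNorm_eq hdense (hR n) u,
    fun v hv => ?_⟩
  -- With `δ = 2^{n₁}` the error is of order `2^{(b - m) n₁}`, so `m ≥ b + d v` is what the rate
  -- requires.
  obtain ⟨m, hm⟩ := exists_nat_ge ((b : ℝ) + ((ds + du : ℕ) : ℝ) * v)
  obtain ⟨D, hD, htail⟩ := hmain m
  refine ⟨D, fun n₀ n₁ _ hn => ?_⟩
  obtain ⟨A, hA, hfar⟩ := AnisoU.exists_finset_lattice hK n₁
  set a : (Fin ds ⊕ Fin du → ℤ) → (AnisoU.USpace χ r hC CF p t hs K →L[ℂ] ℂ) := fun k =>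
    (AnisoU.lowValue χ K n₀ (((2 : ℝ) ^ n₁)⁻¹ • AnisoU.latticePt k)).extendOfNorm
      (AnisoU.toU χ r hC CF p t hs K) with ha
  set w : (Fin ds ⊕ Fin du → ℤ) → AnisoU.USpace χ r hC' CF' p t hs K := fun k =>
    AnisoU.toU χ r hC' CF' p t hs K (AnisoU.atom hK φ κ n₁ k) with hw
  have hav : ∀ k u, a k (AnisoU.toU χ r hC CF p t hs K u) =
      AnisoU.lowValue χ K n₀ (((2 : ℝ) ^ n₁)⁻¹ • AnisoU.latticePt k) u := fun k u =>
    LinearMap.extendOfNorm_eq hdense ⟨_, hval n₀ _⟩ u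
  set T : AnisoU.USpace χ r hC CF p t hs K →L[ℂ] AnisoU.USpace χ r hC' CF' p t hs K :=
    ∑ k ∈ A, (a k).smulRight (w k) with hT
  have hTx : ∀ u, T u = ∑ k ∈ A, a k u • w k := fun u => by
    simp only [hT, sum_apply, ContinuousLinearMap.smulRight_apply]
  have hrange : LinearMap.range T.toLinearMap ≤
      Submodule.span ℂ ((A.image w : Finset _) : Set (AnisoU.USpace χ r hC' CF' p t hs K)) := by
    rintro _ ⟨u, rfl⟩
    change T u ∈ _
    rw [hTx]
    exact Submodule.sum_mem _ fun k hk => Submodule.smul_mem _ _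
      (Submodule.subset_span (Finset.mem_coe.2 (Finset.mem_image_of_mem w hk)))
  have hcard : Module.finrank ℂ (LinearMap.range T.toLinearMap) ≤ A.card :=
    (Submodule.finrank_mono hrange).trans
      ((finrank_span_finset_le_card _).trans Finset.card_image_le)
  refine ⟨T, Submodule.finiteDimensional_of_le hrange,
    (Nat.cast_le.2 hcard).trans hA, fun u => ?_⟩
  -- Both sides are continuous in `u`, so it is enough to take `u` in `C^∞(K)`, where the extended
  -- operators are given by their formulas.
  refine hdense.induction_on u (isClosed_le (by fun_prop) (by fun_prop)) fun u => ?_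
  rw [LinearMap.extendOfNorm_eq hdense (hR n₀), hTx]
  simp only [hav]
  refine (htail n₀ n₁ hn A (2 ^ n₁) (by positivity) hfar u).trans ?_
  have hpow : ((2 : ℝ) ^ n₁) ^ b * (((2 : ℝ) ^ n₁) ^ m)⁻¹ ≤
      (2 : ℝ) ^ (-(((ds + du : ℕ) : ℝ) * v * (n₁ : ℝ))) := by
    rw [← pow_mul, ← pow_mul, ← Real.rpow_natCast, ← Real.rpow_natCast, ← Real.rpow_neg two_pos.le,
      ← Real.rpow_add two_pos]
    refine Real.rpow_le_rpow_of_exponent_le one_le_two ?_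
    have h0 : (0 : ℝ) ≤ n₁ := Nat.cast_nonneg _
    push_cast at hm ⊢
    nlinarith [mul_le_mul_of_nonneg_left hm h0]
  have h0 := norm_nonneg (AnisoU.toU χ r hC CF p t hs K u)
  rw [mul_assoc D]
  gcongr
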